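/- Let $(v_j)_{j\ge 1}$ be a real sequence with finite support, and let $H$ be the discrete Schrödinger operator on the half-line, $(H\psi)_j = v_j\psi(j)+2\psi(j)-\psi(j-1)-\psi(j+1)$ for $j\ge 1$, with Dirichlet condition $\psi(0)=0$. Write $\lambda = 2-z-z^{-1}$ for the spectral parameter and let $\varphi(j)$ be the regular solution of $H\varphi=\lambda\varphi$, i.e. the one with $\varphi(0)=0$, $\varphi(1)=1$. The Jost function is the polynomial $\hat F(z) = 1+\sum_{j\ge1} z^{j} v_j\,\varphi(j)$; for $z=e^{ip}$, $0<p<\pi$, it is the coefficient $F(p)=\hat F(e^{ip})$ in $\varphi(j)=\frac{i}{2\sin p}\left[F(p)f(j,-p)-F(-p)f(j,p)\right]$, where $f(j,\pm p)$ are the Jost solutions, i.e. the solutions of $H f=(2-2\cos p)f$ (without boundary condition) with $f(j,\pm p)-e^{\pm ipj}\to0$ as $j\to\infty$. Assume that $H$ has no bound states (no nonzero square-summable $\psi$ with $\psi(0)=0$ satisfies $H\psi=\lambda\psi$ for any $\lambda$), and that $\hat F(1)\neq0$ and $\hat F(-1)\ne0$. Then: (1) There is a unique continuous, odd, $2\pi$-periodic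 function $\eta:\mathbb R\to\mathbb R$ (the scattering phase) with $\hat F(e^{ip}) = |\hat F(e^{ip})|\,e^{-i\eta(p)}$ for all real $p$. Define $\delta$ on $[0,4]$ by $\delta(2-2\cos p)=\eta(p)$, $0\le p\le\pi$. Then $\delta$ is differentiable on $(0,4)$, the principal value integral below exists for every $\lambda_1\in(0,4)$, both integrals over $(0,4)$ of the resulting functions converge absolutely, and $$\int_0^4 \delta(\lambda)\,\frac{\lambda-2}{\lambda(\lambda-4)}\,d\lambda+\frac1\pi\int_0^4 \delta(\lambda_1)\;\mathcal P\!\!\int_0^4\frac{\delta'(\lambda_2)}{\lambda_2-\lambda_1}\,d\lambda_2\,d\lambda_1=0 .$$ (2) Equivalently, in terms of the Jost function: there is a function $\ln\hat F$, analytic on a neighbourhood of every point of the closed unit disc, with $e^{\ln \hat F(z)}=\hat F(z)$ for $|z|\le1$ and $\ln\hat F(0)=0$; and for this branch $$\ln\hat F(1)+\ln\hat F(-1)+\oint_{|z|=1}\frac{dz}{2\pi i}\,\ln\!\big[\hat F(1/z)\big]\,\frac{d\ln\hat F(z)}{dz}=0,$$ the circle being traversed counter-clockwise. -/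

import Mathlib

open Filter Topology

noncomputable section

namespace HalfLine

/-- `ψ` solves `v_j ψ(j) + [2ψ(j) - ψ(j-1) - ψ(j+1)] = lam ψ(j)` for all `j ≥ 1` (here `j = i + 1`).
The value `v 0` is never used. -/
def IsSolution (v : ℕ → ℝ) (lam : ℂ) (ψ : ℕ → ℂ) : Prop :=
  ∀ i : ℕ, (v (i + 1) : ℂ) * ψ (i + 1) + (2 * ψ (i + 1) - ψ i - ψ (i + 2)) = lam * ψ (i + 1)

/-- The operator on the half-line with Dirichlet condition `ψ(0) = 0` has no square-summable
eigenfunction. -/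
def NoBoundStates (v : ℕ → ℝ) : Prop :=
  ∀ (lam : ℂ) (ψ : ℕ → ℂ), ψ 0 = 0 → IsSolution v lam ψ → Summable (fun j => ‖ψ j‖ ^ 2) → ψ = 0

/-- The regular solution: `φ(0) = 0`, `φ(1) = 1`. -/
def regularSolution (v : ℕ → ℝ) (lam : ℂ) : ℕ → ℂ
  | 0 => 0
  | 1 => 1
  | (i + 2) => (2 + (v (i + 1) : ℂ) - lam) * regularSolution v lam (i + 1) - regularSolution v lam i

/-- The spectral parameter `lam = 2 - z - 1/z`. -/
def spectralParam (z : ℂ) : ℂ := 2 - z - z⁻¹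

/-- The Jost solution `f(j,p)`: a solution at `lam = 2 - 2 cos p` with `f(j,p) - exp(ipj) → 0`. -/
def IsJostSolution (v : ℕ → ℝ) (p : ℝ) (f : ℕ → ℂ) : Prop :=
  IsSolution v (2 - 2 * Real.cos p) f ∧
    Tendsto (fun j : ℕ => f j - Complex.exp (Complex.I * p * j)) atTop (𝓝 0)

/-- The Jost function in the parameter `z = exp(ip)`, `F̂(z) = 1 + ∑_{j ≥ 1} z^j v_j φ(j)`
(the term `j = 0` vanishes since `φ(0) = 0`).  For `v` of finite support it is a polynomial in `z`.
That it is the coefficient in the expansion of the regular solution in the Jost solutions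
`f(·,-p)`, `f(·,p)` is `regularSolution_eq_jost` below. -/
def jostFunction (v : ℕ → ℝ) (z : ℂ) : ℂ :=
  1 + ∑' j : ℕ, z ^ j * (v j : ℂ) * regularSolution v (spectralParam z) j

/-- The scattering phase `η`: the continuous, odd, `2π`-periodic function with
`F(p) = |F(p)| exp(-i η(p))`. -/
structure IsScatteringPhase (v : ℕ → ℝ) (η : ℝ → ℝ) : Prop where
  continuous : Continuous η
  odd : ∀ p, η (-p) = -η p
  periodic : ∀ p, η (p + 2 * Real.pi) = η p
  polar : ∀ p : ℝ, jostFunction v (Complex.exp (Complex.I * p)) =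
    (‖jostFunction v (Complex.exp (Complex.I * p))‖ : ℂ) * Complex.exp (-(Complex.I * η p))

/-- The phase in terms of the spectral parameter: `δ(2 - 2 cos p) = η(p)` for `0 ≤ p ≤ π`. -/
def spectralPhase (η : ℝ → ℝ) (x : ℝ) : ℝ := η (Real.arccos (1 - x / 2))

/-- The principal value of `∫_a^b f`, with a singularity at the interior point `c`, exists and
equals `I`. -/
def HasPrincipalValue (f : ℝ → ℝ) (a b c I : ℝ) : Prop :=
  (∀ᶠ ε in 𝓝[>] (0 : ℝ), IntervalIntegrable f MeasureTheory.volume a (c - ε) ∧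
      IntervalIntegrable f MeasureTheory.volume (c + ε) b) ∧
    Tendsto (fun ε : ℝ => (∫ x in a..(c - ε), f x) + ∫ x in (c + ε)..b, f x) (𝓝[>] 0) (𝓝 I)

/-- `L` is the analytic branch of `ln F̂` on the closed unit disc with `ln F̂(0) = ln 1 = 0`. -/
structure IsLogJost (v : ℕ → ℝ) (L : ℂ → ℂ) : Prop where
  analytic : AnalyticOnNhd ℂ L (Metric.closedBall 0 1)
  exp_eq : ∀ z ∈ Metric.closedBall (0 : ℂ) 1, Complex.exp (L z) = jostFunction v z
  zero : L 0 = 0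

/-! The Jost function defined above is the one given by the Jost solutions. -/

theorem regularSolution_isSolution (v : ℕ → ℝ) (lam : ℂ) :
    IsSolution v lam (regularSolution v lam) := by
  intro i
  simp only [regularSolution]
  ring

theorem IsSolution.ext_right {v : ℕ → ℝ} {lam : ℂ} {ψ χ : ℕ → ℂ} (h1 : IsSolution v lam ψ)
    (h2 : IsSolution v lam χ) : ∀ N : ℕ, ψ N = χ N → ψ (N + 1) = χ (N + 1) → ∀ j ≤ N, ψ j = χ j
  | 0, h, _, j, hj => by
      obtain rfl : j = 0 := by omega
      exact h
  | N + 1, h, h', j, hj => by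
      have e : ψ N = χ N := by
        have a := h1 N
        have b := h2 N
        rw [h, h'] at a
        linear_combination b - a
      rcases Nat.lt_or_ge N j with hh | hh
      · obtain rfl : j = N + 1 := by omega
        exact h
      · exact IsSolution.ext_right h1 h2 N e h j hh

theorem regularSolution_partial (v : ℕ → ℝ) (z : ℂ) (hz : z ≠ 0) (j : ℕ) :
    (z - z⁻¹) * regularSolution v (spectralParam z) j =
      z ^ j * (1 + ∑ i ∈ Finset.range j, z⁻¹ ^ i * (v i : ℂ) * regularSolution v (spectralParam z) i)
      - z⁻¹ ^ j *
        (1 + ∑ i ∈ Finset.range j, z ^ i * (v i : ℂ) * regularSolution v (spectralParam z) i) := by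
  induction j using Nat.twoStepInduction with
  | zero => simp [regularSolution]
  | one => simp [regularSolution]
  | more n h0 h1 =>
    have hzz : z * z⁻¹ = 1 := mul_inv_cancel₀ hz
    have hp : z ^ n * z⁻¹ ^ n = 1 := by rw [← mul_pow, hzz, one_pow]
    have e : regularSolution v (spectralParam z) (n + 2) =
        ((v (n + 1) : ℂ) + z + z⁻¹) * regularSolution v (spectralParam z) (n + 1)
          - regularSolution v (spectralParam z) n := by
      simp only [regularSolution, spectralParam]
      ring
    rw [e]
    simp only [Finset.sum_range_succ] at h1 ⊢
    set S := ∑ i ∈ Finset.range n, z ^ i * (v i : ℂ) * regularSolution v (spectralParam z) i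
    set T := ∑ i ∈ Finset.range n, z⁻¹ ^ i * (v i : ℂ) * regularSolution v (spectralParam z) i
    set a := regularSolution v (spectralParam z) n
    set b := regularSolution v (spectralParam z) (n + 1)
    set w := z⁻¹
    simp only [pow_succ] at h1 ⊢
    generalize z ^ n = Z at *
    generalize w ^ n = W at *
    generalize (v n : ℂ) = vn at *
    generalize (v (n + 1) : ℂ) = vm at *
    linear_combination (z + w) * h1 - h0 - (z - w) * vm * b * (z * w * hp + hzz) +
      (Z * (1 + (T + W * vn * a)) - W * (1 + (S + Z * vn * a))) * hzz

theorem jostFunction_eq_sum (v : ℕ → ℝ) (J : ℕ) (hv : ∀ j, J < j → v j = 0) (z : ℂ) (N : ℕ)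
    (hN : J < N) : jostFunction v z =
      1 + ∑ i ∈ Finset.range N, z ^ i * (v i : ℂ) * regularSolution v (spectralParam z) i := by
  unfold jostFunction
  rw [tsum_eq_sum (s := Finset.range N)]
  intro j hj
  rw [Finset.mem_range, not_lt] at hj
  simp [hv j (by omega)]

theorem spectralParam_exp (p : ℝ) :
    spectralParam (Complex.exp (Complex.I * p)) = 2 - 2 * Real.cos p := by
  have h : (2 : ℂ) * Complex.cos p = _ := Complex.two_cos (p : ℂ)
  rw [spectralParam, ← Complex.exp_neg, Complex.ofReal_cos, h,
    mul_comm Complex.I, neg_mul]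
  ring

/-- For a potential of finite support the Jost solution is exactly a plane wave to the right of the
support. -/
theorem IsJostSolution.eq_exp {v : ℕ → ℝ} {J : ℕ} (hv : ∀ j, J < j → v j = 0) {p : ℝ}
    (hp : Real.sin p ≠ 0) {f : ℕ → ℂ} (hf : IsJostSolution v p f) (j : ℕ) (hj : J ≤ j) :
    f j = Complex.exp (Complex.I * p) ^ j := by
  obtain ⟨hs, hl⟩ := hf
  set z := Complex.exp (Complex.I * p) with hzdef
  have hz : z ≠ 0 := Complex.exp_ne_zero _
  have hzz : z * z⁻¹ = 1 := mul_inv_cancel₀ hz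
  have hlam : (2 : ℂ) - 2 * Real.cos p = 2 - z - z⁻¹ := (spectralParam_exp p).symm
  have hnz : ‖z‖ = 1 := by rw [hzdef, mul_comm]; exact Complex.norm_exp_ofReal_mul_I p
  have hne : z - z⁻¹ ≠ 0 := by
    intro h
    apply hp
    have h2 : (2 : ℂ) * Complex.sin p = _ := Complex.two_sin (p : ℂ)
    rw [hzdef, ← Complex.exp_neg, mul_comm Complex.I, ← neg_mul] at h
    have h3 : (2 : ℂ) * Complex.sin p = 0 := by
      rw [h2]
      linear_combination (-Complex.I) * h
    have h4 : Complex.sin p = 0 := by simpa using h3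
    exact_mod_cast h4
  set g : ℕ → ℂ := fun j => f j - z ^ j with hg
  have hgl : Tendsto g atTop (𝓝 0) := by
    refine hl.congr fun n => ?_
    simp only [hg, hzdef]
    rw [← Complex.exp_nat_mul, mul_comm (n : ℂ)]
  have hrec : ∀ n, J ≤ n → g (n + 2) = (z + z⁻¹) * g (n + 1) - g n := by
    intro n hn
    have h1 := hs n
    rw [hlam, hv (n + 1) (by omega)] at h1
    simp only [hg]
    rw [Complex.ofReal_zero] at h1
    linear_combination (-1 : ℂ) * h1 + (z ^ n) * hzz
  have key : ∀ u w : ℂ, ‖u‖ = 1 → u * w = 1 →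
      (∀ n, J ≤ n → g (n + 2) = (u + w) * g (n + 1) - g n) → ∀ n, J ≤ n → g (n + 1) = u * g n := by
    intro u w hu huw hr n hn
    have hw : ‖w‖ = 1 := by
      have := congrArg norm huw
      rw [norm_mul, hu, one_mul, norm_one] at this
      exact this
    have hconst : ∀ k, ‖g (n + k + 1) - u * g (n + k)‖ = ‖g (n + 1) - u * g n‖ := by
      intro k
      induction k with
      | zero => rfl
      | succ k ih =>
        rw [← ih]
        have e : g (n + (k + 1) + 1) - u * g (n + (k + 1)) = w * (g (n + k + 1) - u * g (n + k)) := by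
          have := hr (n + k) (by omega)
          rw [show n + (k + 1) + 1 = n + k + 2 by ring, show n + (k + 1) = n + k + 1 by ring, this]
          linear_combination g (n + k) * huw
        rw [e, norm_mul, hw, one_mul]
    have hlim : Tendsto (fun k : ℕ => ‖g (n + k + 1) - u * g (n + k)‖) atTop (𝓝 0) := by
      have a : Tendsto (fun k : ℕ => g (n + k + 1)) atTop (𝓝 0) :=
        hgl.comp (tendsto_atTop_mono (fun k => by omega : ∀ k, k ≤ n + k + 1) tendsto_id)
      have b : Tendsto (fun k : ℕ => g (n + k)) atTop (𝓝 0) :=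
        hgl.comp (tendsto_atTop_mono (fun k => by omega : ∀ k, k ≤ n + k) tendsto_id)
      have c := (a.sub (b.const_mul u)).norm
      simpa using c
    have h0 := tendsto_nhds_unique hlim
      (by simp only [hconst]; exact tendsto_const_nhds)
    exact sub_eq_zero.mp (norm_eq_zero.mp h0.symm)
  have k1 := key z z⁻¹ hnz hzz hrec j hj
  have k2 := key z⁻¹ z (by rw [norm_inv, hnz, inv_one]) (by rw [mul_comm]; exact hzz)
    (by intro n hn; rw [add_comm z⁻¹ z]; exact hrec n hn) j hj
  have h0 : (z - z⁻¹) * g j = 0 := by linear_combination k2 - k1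
  exact sub_eq_zero.mp ((mul_eq_zero.mp h0).resolve_left hne)

/-- The expansion of the regular solution in the two Jost solutions, with coefficient the Jost
function: `φ(j,p) = i / (2 sin p) [F(p) f(j,-p) - F(-p) f(j,p)]`. -/
theorem regularSolution_eq_jost (v : ℕ → ℝ) (hv : ∃ J : ℕ, ∀ j, J < j → v j = 0) (p : ℝ)
    (hp : Real.sin p ≠ 0) (fp fm : ℕ → ℂ) (hfp : IsJostSolution v p fp)
    (hfm : IsJostSolution v (-p) fm) (j : ℕ) :
    regularSolution v (2 - 2 * Real.cos p) j = Complex.I / (2 * Real.sin p) *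
      (jostFunction v (Complex.exp (Complex.I * p)) * fm j -
        jostFunction v (Complex.exp (Complex.I * (-p : ℝ))) * fp j) := by
  obtain ⟨J, hJ⟩ := hv
  set c := Complex.I / (2 * Real.sin p)
  set F := jostFunction v (Complex.exp (Complex.I * p)) with hF
  set G := jostFunction v (Complex.exp (Complex.I * (-p : ℝ))) with hG
  have hsol : IsSolution v (2 - 2 * Real.cos p) fun j => c * (F * fm j - G * fp j) := by
    intro i
    have a := hfp.1 i
    have b := hfm.1 i
    rw [Real.cos_neg] at b
    linear_combination c * F * b - c * G * a
  have hsp : ((Real.sin p : ℝ) : ℂ) ≠ 0 := by exact_mod_cast hp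
  have hinv : Complex.exp (Complex.I * (-p : ℝ)) = (Complex.exp (Complex.I * p))⁻¹ := by
    rw [← Complex.exp_neg]
    push_cast
    ring_nf
  have hright : ∀ n, J < n →
      regularSolution v (2 - 2 * Real.cos p) n = c * (F * fm n - G * fp n) := by
    intro n hn
    have e1 := hfp.eq_exp hJ hp n hn.le
    have e2 := hfm.eq_exp hJ (by rw [Real.sin_neg]; exact neg_ne_zero.mpr hp) n hn.le
    rw [hinv] at e2
    have h := regularSolution_partial v _ (Complex.exp_ne_zero (Complex.I * p)) n
    have hs : spectralParam (Complex.exp (Complex.I * p))⁻¹ =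
        spectralParam (Complex.exp (Complex.I * p)) := by
      simp only [spectralParam, inv_inv]
      ring
    have hF' := jostFunction_eq_sum v J hJ (Complex.exp (Complex.I * p)) n hn
    have hG' := jostFunction_eq_sum v J hJ (Complex.exp (Complex.I * p))⁻¹ n hn
    rw [hs] at hG'
    rw [← hF', ← hG', ← hinv, ← hF, ← hG, hinv, ← e1, ← e2, spectralParam_exp] at h
    have hd : Complex.exp (Complex.I * p) - (Complex.exp (Complex.I * p))⁻¹ =
        2 * Complex.I * Real.sin p := by
      have h2 : (2 : ℂ) * Complex.sin p = _ := Complex.two_sin (p : ℂ)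
      rw [← Complex.exp_neg, Complex.ofReal_sin, mul_comm Complex.I, ← neg_mul]
      linear_combination (-Complex.I) * h2 - (Complex.exp (-p * Complex.I) -
        Complex.exp (p * Complex.I)) * Complex.I_mul_I
    rw [hd] at h
    simp only [c]
    generalize regularSolution v (2 - 2 * Real.cos p) n = R at h ⊢
    field_simp
    linear_combination (-Complex.I) * h + 2 * Real.sin p * R * Complex.I_mul_I
  exact IsSolution.ext_right (regularSolution_isSolution v _) hsol (max j (J + 1))
    (hright _ (by omega)) (hright _ (by omega)) j (le_max_left _ _)

/-- Solutions with prescribed values at two neighbouring sites exist. -/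
theorem exists_isSolution (v : ℕ → ℝ) (lam : ℂ) (N : ℕ) :
    ∀ a b : ℂ, ∃ ψ : ℕ → ℂ, IsSolution v lam ψ ∧ ψ N = a ∧ ψ (N + 1) = b := by
  induction N with
  | zero =>
    intro a b
    let st : ℕ → ℂ × ℂ := fun n => Nat.rec (a, b)
      (fun i x => (x.2, (2 + (v (i + 1) : ℂ) - lam) * x.2 - x.1)) n
    refine ⟨fun n => (st n).1, fun i => ?_, rfl, rfl⟩
    change (v (i + 1) : ℂ) * (st i).2 + (2 * (st i).2 - (st i).1 -
      ((2 + (v (i + 1) : ℂ) - lam) * (st i).2 - (st i).1)) = lam * (st i).2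
    ring
  | succ N ih =>
    intro a b
    obtain ⟨ψ, h, h0, h1⟩ := ih ((2 + (v (N + 1) : ℂ) - lam) * a - b) a
    refine ⟨ψ, h, h1, ?_⟩
    have := h N
    rw [h0, h1] at this
    linear_combination (-1 : ℂ) * this

theorem exists_isJostSolution (v : ℕ → ℝ) (hv : ∃ J : ℕ, ∀ j, J < j → v j = 0) (p : ℝ) :
    ∃ f : ℕ → ℂ, IsJostSolution v p f := by
  obtain ⟨J, hJ⟩ := hv
  set z := Complex.exp (Complex.I * p) with hzdef
  have hz : z ≠ 0 := Complex.exp_ne_zero _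
  have hzz : z * z⁻¹ = 1 := mul_inv_cancel₀ hz
  have hlam : (2 : ℂ) - 2 * Real.cos p = 2 - z - z⁻¹ := (spectralParam_exp p).symm
  obtain ⟨f, hf, h0, h1⟩ := exists_isSolution v (2 - 2 * Real.cos p) J (z ^ J) (z ^ (J + 1))
  refine ⟨f, hf, ?_⟩
  have hk : ∀ k, f (J + k) = z ^ (J + k) ∧ f (J + k + 1) = z ^ (J + k + 1) := by
    intro k
    induction k with
    | zero => exact ⟨h0, h1⟩
    | succ k ih =>
      refine ⟨ih.2, ?_⟩
      have h2 := hf (J + k)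
      rw [hlam, hJ (J + k + 1) (by omega), ih.1, ih.2, Complex.ofReal_zero] at h2
      rw [show J + (k + 1) + 1 = J + k + 2 by ring]
      linear_combination (-1 : ℂ) * h2 + z ^ (J + k) * hzz
  refine tendsto_const_nhds.congr' ?_
  filter_upwards [eventually_ge_atTop J] with n hn
  obtain ⟨k, rfl⟩ := Nat.exists_eq_add_of_le hn
  rw [(hk k).1, hzdef, ← Complex.exp_nat_mul, mul_comm ((J + k : ℕ) : ℂ), sub_self]

end HalfLine

end

/-! The Jost function is a polynomial with value 1 at the origin. Absence of bound states and F̂(±1)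
≠ 0 keep its zeros outside the closed unit disc (`jostFunction_ne_zero`), so F̂(z) = ∏ (1 - a_i z)
with |a_i| < 1 and the family a_i closed under conjugation. Then L(z) = Σ log(1 - a_i z) is the
required logarithm, and both forms of the theorem reduce to one algebraic identity, ∏ F̂(a_i) = ∏ (1
- a_i²).

The identity (`jostPoly_prod_roots`) comes from building the potential site by site from its far
end. The Jost polynomials P_k of the successive pieces obey a three-term recurrence with a conserved
Wronskian in z and 1/z. At a zero 1/a of P_{k+1} one Wronskian term drops out, leaving P_{k+1}(a)
times a value of P_k. The product of the latter values over all zeros is a resultant, and the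
recurrence evaluates it by the Euclidean algorithm (`reversedJostC_prod_eval`).

By Cauchy's theorem the contour integral is -Σ L(a_i), while L(1) + L(-1) = Σ log(1 - a_i²). The
identity says that these two sums have the same exponential; conjugation symmetry makes both real,
so no multiple of 2πi can separate them (`logProd_constraint`).

For the real form put λ = 2 - 2 cos p. The first integral becomes ∫ η cot p dp = -(π/2)(L(1) +
L(-1)). The principal value is explicit, -(π/2) Σ a_i / (1 - 2 a_i cos p + a_i²), and its integral
against the phase is (π²/2) Σ L(a_i). The same identity finishes the proof. -/

noncomputable section

namespace HalfLine

section Polynomials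

open Polynomial

/-! ### The reversed Jost polynomials -/

/-- The monic reversal of the Jost polynomial of the potential `u k, u (k - 1), …, u 0`. -/
def reversedJost (u : ℕ → ℝ) : ℕ → ℝ[X]
  | 0 => X + C (u 0)
  -- The empty potential has Jost polynomial 1, whose reversal in formal degree -1 is X⁻¹; the last
  -- term is X² · X⁻¹.
  | 1 => (X ^ 2 + C (u 1) * X + 1) * (X + C (u 0)) - X
  | k + 2 => (X ^ 2 + C (u (k + 2)) * X + 1) * reversedJost u (k + 1) - X ^ 2 * reversedJost u k

/-- The Jost polynomial of the potential `u k, u (k - 1), …, u 0`. -/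
def jostPoly (u : ℕ → ℝ) : ℕ → ℂ → ℂ
  | 0, z => 1 + u 0 * z
  | 1, z => (1 + u 1 * z + z ^ 2) * (1 + u 0 * z) - z ^ 2
  | k + 2, z => (1 + u (k + 2) * z + z ^ 2) * jostPoly u (k + 1) z - z ^ 2 * jostPoly u k z

theorem natDegree_quadratic (a : ℝ) : (X ^ 2 + C a * X + 1 : ℝ[X]).natDegree = 2 := by
  compute_degree!

theorem monic_quadratic (a : ℝ) : (X ^ 2 + C a * X + 1 : ℝ[X]).Monic := by
  monicity!

/-- The Jost polynomial itself may lose degree when u 0 = 0; its reversal is monic of fixed degree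
for every u, so resultants need no leading coefficients. -/
theorem reversedJost_monic_natDegree (u : ℕ → ℝ) (k : ℕ) :
    (reversedJost u k).Monic ∧ (reversedJost u k).natDegree = 2 * k + 1 := by
  have main : ∀ (a : ℝ) (p q : ℝ[X]), p.Monic → q.natDegree < p.natDegree + 2 →
      ((X ^ 2 + C a * X + 1) * p - q).Monic ∧
        ((X ^ 2 + C a * X + 1) * p - q).natDegree = p.natDegree + 2 := by
    intro a p q hp hq
    have hm : ((X ^ 2 + C a * X + 1) * p).Monic := (monic_quadratic a).mul hp
    have hd : ((X ^ 2 + C a * X + 1) * p).natDegree = p.natDegree + 2 := by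
      rw [(monic_quadratic a).natDegree_mul hp, natDegree_quadratic, add_comm]
    have hlt : q.degree < ((X ^ 2 + C a * X + 1) * p).degree := by
      apply degree_lt_degree
      rwa [hd]
    exact ⟨hm.sub_of_left hlt, by rw [natDegree_sub_eq_left_of_natDegree_lt (by rwa [hd]), hd]⟩
  induction k using Nat.twoStepInduction with
  | zero => exact ⟨monic_X_add_C _, natDegree_X_add_C _⟩
  | one =>
    have := main (u 1) (X + C (u 0)) X (monic_X_add_C _) (by simp)
    rwa [natDegree_X_add_C] at this
  | more n h0 h1 =>
    have := main (u (n + 2)) _ (X ^ 2 * reversedJost u n) h1.1 (by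
      rw [(monic_X_pow 2).natDegree_mul h0.1, natDegree_X_pow, h0.2, h1.2]; omega)
    rw [h1.2] at this
    exact this

theorem reversedJost_eval_zero (u : ℕ → ℝ) (k : ℕ) : (reversedJost u k).eval 0 = u 0 := by
  induction k using Nat.twoStepInduction with
  | zero => simp [reversedJost]
  | one => simp [reversedJost]
  | more n h0 h1 => simp [reversedJost, h1]

theorem jostPoly_zero (u : ℕ → ℝ) (k : ℕ) : jostPoly u k 0 = 1 := by
  induction k using Nat.twoStepInduction with
  | zero => simp [jostPoly]
  | one => simp [jostPoly]
  | more n h0 h1 => simp [jostPoly, h1]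

theorem jostPoly_eq_reversed (u : ℕ → ℝ) {z w : ℂ} (h : z * w = 1) (k : ℕ) :
    jostPoly u k z = z ^ (2 * k + 1) * ((reversedJost u k).map Complex.ofRealHom).eval w := by
  induction k using Nat.twoStepInduction with
  | zero =>
    simp [jostPoly, reversedJost]
    linear_combination -h
  | one =>
    simp [jostPoly, reversedJost]
    have e : w = z⁻¹ := eq_inv_of_mul_eq_one_right h
    have hz : z ≠ 0 := left_ne_zero_of_mul_eq_one h
    subst e
    field_simp
  | more n h0 h1 =>
    have e : w = z⁻¹ := eq_inv_of_mul_eq_one_right h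
    have hz : z ≠ 0 := left_ne_zero_of_mul_eq_one h
    simp only [jostPoly, reversedJost, h0, h1]
    simp only [Polynomial.map_sub, Polynomial.map_mul, Polynomial.map_add, Polynomial.map_pow,
      map_X, map_C, Polynomial.map_one, eval_sub, eval_mul, eval_add, eval_pow, eval_X, eval_C,
      eval_one, Complex.ofRealHom_eq_coe]
    generalize ((reversedJost u n).map Complex.ofRealHom).eval w = A
    generalize ((reversedJost u (n + 1)).map Complex.ofRealHom).eval w = B
    subst e
    rw [show 2 * (n + 2) + 1 = 2 * n + 5 by ring, show 2 * (n + 1) + 1 = 2 * n + 3 by ring]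
    field_simp
    ring

/-! ### Wronskian, resultant and the constraint on the zeros -/

/-- Up to powers of z and w = 1/z, the values at z and w are two solutions of the same difference
equation, so their Wronskian is the same at every site. The stray factors w and z are what remains
of those powers. -/
theorem jostPoly_wronskian (u : ℕ → ℝ) {z w : ℂ} (h : z * w = 1) (k : ℕ) :
    w * jostPoly u (k + 1) z * jostPoly u k w - z * jostPoly u k z * jostPoly u (k + 1) w =
      w - z := by
  induction k with
  | zero =>
    simp only [jostPoly]
    linear_combination ((z - w) * (1 + u 0 * z) * (1 + u 0 * w)
      + (w - z)) * h
  | succ n ih =>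
    simp only [jostPoly]
    linear_combination ih + (z * jostPoly u (n + 1) w * jostPoly u (n + 1) z
      - w * jostPoly u (n + 1) w * jostPoly u (n + 1) z
      - z * jostPoly u n z * jostPoly u (n + 1) w + w * jostPoly u n w * jostPoly u (n + 1) z) * h

/-- For monic polynomials both products are resultants, and exchanging the arguments costs only a
sign. -/
theorem prod_eval_roots_comm {f g : ℂ[X]} (hf : f.Monic) (hg : g.Monic) :
    (f.roots.map fun a => g.eval a).prod =
      (-1) ^ (f.natDegree * g.natDegree) * (g.roots.map fun a => f.eval a).prod := by
  have h1 := resultant_eq_prod_eval f g _ le_rfl (IsAlgClosed.splits f)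
  have h2 := resultant_eq_prod_eval g f _ le_rfl (IsAlgClosed.splits g)
  rw [hf.leadingCoeff, one_pow, one_mul] at h1
  rw [hg.leadingCoeff, one_pow, one_mul] at h2
  rw [← h1, ← h2, resultant_comm]

/-- The complexified reversed Jost polynomial. -/
def reversedJostC (u : ℕ → ℝ) (k : ℕ) : ℂ[X] := (reversedJost u k).map Complex.ofRealHom

theorem reversedJostC_monic (u : ℕ → ℝ) (k : ℕ) : (reversedJostC u k).Monic :=
  (reversedJost_monic_natDegree u k).1.map _

theorem reversedJostC_natDegree (u : ℕ → ℝ) (k : ℕ) :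
    (reversedJostC u k).natDegree = 2 * k + 1 := by
  rw [reversedJostC, (reversedJost_monic_natDegree u k).1.natDegree_map,
    (reversedJost_monic_natDegree u k).2]

theorem reversedJostC_eval_zero (u : ℕ → ℝ) (k : ℕ) : (reversedJostC u k).eval 0 = u 0 := by
  have := Polynomial.eval_map_apply (p := reversedJost u k) Complex.ofRealHom (0 : ℝ)
  rw [reversedJost_eval_zero] at this
  simpa [reversedJostC] using this

theorem reversedJostC_roots_prod (u : ℕ → ℝ) (k : ℕ) : (reversedJostC u k).roots.prod = -u 0 := by
  have := (IsAlgClosed.splits (reversedJostC u k)).coeff_zero_eq_prod_roots_of_monic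
    (reversedJostC_monic u k)
  rw [coeff_zero_eq_eval_zero, reversedJostC_eval_zero, reversedJostC_natDegree, pow_succ,
    pow_mul] at this
  simp at this
  rw [this, neg_neg]

/-- Euclidean algorithm for the resultant of neighbours: at a root of R_{n+1} the recurrence reads
R_{n+2} = -X² R_n. Each step thus contributes the squared product of the roots, u 0 ², and two signs
(odd degrees) that cancel. -/
theorem reversedJostC_prod_eval (u : ℕ → ℝ) (k : ℕ) :
    ((reversedJostC u (k + 1)).roots.map fun a => (reversedJostC u k).eval a).prod =
      (-(u 0 : ℂ)) ^ (2 * k + 1) := by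
  have swap : ∀ n, ((reversedJostC u (n + 1)).roots.map fun a => (reversedJostC u n).eval a).prod =
      - ((reversedJostC u n).roots.map fun a => (reversedJostC u (n + 1)).eval a).prod := by
    intro n
    rw [prod_eval_roots_comm (reversedJostC_monic u _) (reversedJostC_monic u _),
      reversedJostC_natDegree, reversedJostC_natDegree, Odd.neg_one_pow]
    · ring
    · exact Odd.mul ⟨_, rfl⟩ ⟨_, rfl⟩
  induction k with
  | zero =>
    rw [swap]
    have : reversedJostC u 0 = X - C (-(u 0 : ℂ)) := by
      simp [reversedJostC, reversedJost]
    rw [this, roots_X_sub_C]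
    simp [reversedJostC, reversedJost]
  | succ n ih =>
    rw [swap]
    have h : ∀ a ∈ (reversedJostC u (n + 1)).roots, (reversedJostC u (n + 2)).eval a =
        -1 * (a * a * (reversedJostC u n).eval a) := by
      intro a ha
      have h0 : (reversedJostC u (n + 1)).eval a = 0 := (mem_roots'.mp ha).2
      simp only [reversedJostC] at h0 ⊢
      simp only [reversedJost, Polynomial.map_sub, Polynomial.map_mul, eval_sub, eval_mul, h0,
        Polynomial.map_pow, map_X, eval_pow, eval_X]
      ring
    rw [Multiset.map_congr rfl h, Multiset.prod_map_mul, Multiset.prod_map_mul,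
      Multiset.prod_map_mul, ih]
    simp only [Multiset.map_id', reversedJostC_roots_prod, Multiset.map_const',
      Multiset.prod_replicate]
    rw [← (IsAlgClosed.splits (reversedJostC u (n + 1))).natDegree_eq_card_roots,
      reversedJostC_natDegree, Odd.neg_one_pow ⟨_, rfl⟩]
    ring

theorem jostPoly_eq_prod (u : ℕ → ℝ) (k : ℕ) (z : ℂ) :
    jostPoly u k z = ((reversedJostC u k).roots.map fun a => 1 - a * z).prod := by
  rcases eq_or_ne z 0 with rfl | hz
  · simp [jostPoly_zero]
  rw [jostPoly_eq_reversed u (mul_inv_cancel₀ hz)]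
  change z ^ (2 * k + 1) * (reversedJostC u k).eval z⁻¹ = _
  rw [(IsAlgClosed.splits (reversedJostC u k)).eval_eq_prod_roots_of_monic
    (reversedJostC_monic u k)]
  have hc : Multiset.card (reversedJostC u k).roots = 2 * k + 1 := by
    rw [← (IsAlgClosed.splits (reversedJostC u k)).natDegree_eq_card_roots,
      reversedJostC_natDegree]
  rw [← hc, ← Multiset.prod_replicate, ← Multiset.map_const', ← Multiset.prod_map_mul]
  refine congrArg _ (Multiset.map_congr rfl fun a _ => ?_)
  field_simp

theorem reversedJostC_roots_ne_zero (u : ℕ → ℝ) (hu : u 0 ≠ 0) (k : ℕ) (a : ℂ)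
    (ha : a ∈ (reversedJostC u k).roots) : a ≠ 0 := by
  rintro rfl
  have h0 : (reversedJostC u k).eval 0 = 0 := (mem_roots'.mp ha).2
  rw [reversedJostC_eval_zero] at h0
  exact hu (by exact_mod_cast h0)

theorem reversedJostC_roots_conj (u : ℕ → ℝ) (k : ℕ) :
    (reversedJostC u k).roots.map (starRingEnd ℂ) = (reversedJostC u k).roots := by
  rw [← (IsAlgClosed.splits (reversedJostC u k)).roots_map, reversedJostC, Polynomial.map_map]
  congr 2
  ext x
  simp

/-- The constraint on the zeros of the Jost polynomial. -/
theorem jostPoly_prod_roots (u : ℕ → ℝ) (hu : u 0 ≠ 0) (k : ℕ) :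
    ((reversedJostC u k).roots.map fun a => jostPoly u k a).prod =
      ((reversedJostC u k).roots.map fun a => 1 - a ^ 2).prod := by
  -- For a root a of the reversal, 1/a is a zero of the Jost polynomial, so one of the two Wronskian
  -- terms vanishes.
  have key : ∀ n, ∀ a ∈ (reversedJostC u (n + 1)).roots,
      (reversedJostC u n).eval a * jostPoly u (n + 1) a = a ^ (2 * n + 1) * (1 - a ^ 2) := by
    intro n a ha
    have ha0 := reversedJostC_roots_ne_zero u hu _ a ha
    have h := inv_mul_cancel₀ ha0
    have hw := jostPoly_wronskian u h n
    have hz : jostPoly u (n + 1) a⁻¹ = 0 := by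
      rw [jostPoly_eq_reversed u h]
      have h0 : (reversedJostC u (n + 1)).eval a = 0 := (mem_roots'.mp ha).2
      rw [reversedJostC] at h0
      rw [h0, mul_zero]
    rw [hz, jostPoly_eq_reversed u h n] at hw
    change a * 0 * _ - a⁻¹ * (a⁻¹ ^ (2 * n + 1) * (reversedJostC u n).eval a) * _ = _ at hw
    generalize (reversedJostC u n).eval a = A at *
    generalize jostPoly u (n + 1) a = B at *
    rw [inv_pow] at hw
    field_simp at hw
    linear_combination -hw
  cases k with
  | zero =>
    have : reversedJostC u 0 = X - C (-(u 0 : ℂ)) := by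
      simp [reversedJostC, reversedJost]
    rw [this, roots_X_sub_C]
    simp [jostPoly]
    ring
  | succ n =>
    have h := congrArg Multiset.prod (Multiset.map_congr rfl (key n))
    rw [Multiset.prod_map_mul, Multiset.prod_map_mul, reversedJostC_prod_eval,
      Multiset.prod_map_pow, Multiset.map_id', reversedJostC_roots_prod] at h
    -- The common factor (-u 0)^(2n+1) is the resultant on the left and a power of the product of
    -- the roots on the right.
    refine mul_left_cancel₀ (pow_ne_zero _ (neg_ne_zero.mpr ?_)) h
    exact_mod_cast hu

end Polynomials

/-! ### Zeros of the Jost function -/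

theorem regularSolution_wronskian (v : ℕ → ℝ) {z : ℂ} (hz : z ≠ 0) (n : ℕ) :
    z ^ n * regularSolution v (spectralParam z) (n + 1) -
      z ^ (n + 1) * regularSolution v (spectralParam z) n =
      1 + ∑ i ∈ Finset.range (n + 1), z ^ i * (v i : ℂ) * regularSolution v (spectralParam z) i := by
  induction n with
  | zero => simp [regularSolution]
  | succ n ih =>
    rw [Finset.sum_range_succ, ← add_assoc, ← ih]
    have e : regularSolution v (spectralParam z) (n + 2) =
        ((v (n + 1) : ℂ) + z + z⁻¹) * regularSolution v (spectralParam z) (n + 1)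
          - regularSolution v (spectralParam z) n := by
      simp only [regularSolution, spectralParam]
      ring
    rw [e]
    field_simp
    ring

/-- Right of the support the partial sums no longer change. A zero of F̂ at z therefore means that φ
is geometric with ratio z there. -/
theorem jostFunction_eq_wronskian (v : ℕ → ℝ) (J : ℕ) (hv : ∀ j, J < j → v j = 0) {z : ℂ}
    (hz : z ≠ 0) (n : ℕ) (hn : J ≤ n) : jostFunction v z =
      z ^ n * regularSolution v (spectralParam z) (n + 1) -
        z ^ (n + 1) * regularSolution v (spectralParam z) n := by
  rw [regularSolution_wronskian v hz, jostFunction_eq_sum v J hv z (n + 1) (by omega)]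

theorem jostFunction_zero (v : ℕ → ℝ) : jostFunction v 0 = 1 := by
  have : ∀ j : ℕ, (0 : ℂ) ^ j * (v j : ℂ) * regularSolution v (spectralParam 0) j = 0 := by
    intro j
    rcases j with _ | j <;> simp [regularSolution]
  simp [jostFunction, this]

theorem IsSolution.wronskian {v : ℕ → ℝ} {lam : ℂ} {ψ χ : ℕ → ℂ} (h1 : IsSolution v lam ψ)
    (h2 : IsSolution v lam χ) (n : ℕ) :
    ψ n * χ (n + 1) - ψ (n + 1) * χ n = ψ 0 * χ 1 - ψ 1 * χ 0 := by
  induction n with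
  | zero => rfl
  | succ n ih =>
    rw [← ih]
    linear_combination χ (n + 1) * h1 n - ψ (n + 1) * h2 n

/-- Continue the solution that equals z^j at sites K + 1 and K + 2 back to the origin: at site K - k
it is z^(K-k) times the k-th Jost polynomial. Its value at 0 is F̂(z), by constancy of its Wronskian
with φ. -/
theorem jostFunction_eq_jostPoly (v : ℕ → ℝ) (K : ℕ) (hv : ∀ j, K + 1 < j → v j = 0) (z : ℂ) :
    jostFunction v z = jostPoly (fun k => v (K + 1 - k)) K z := by
  rcases eq_or_ne z 0 with rfl | hz
  · rw [jostFunction_zero, jostPoly_zero]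
  obtain ⟨f, hf, h0, h1⟩ :=
    exists_isSolution v (spectralParam z) (K + 1) (z ^ (K + 1)) (z ^ (K + 2))
  have hzz : z * z⁻¹ = 1 := mul_inv_cancel₀ hz
  have hk : ∀ k m, m + k = K → f m = z ^ m * jostPoly (fun k => v (K + 1 - k)) k z := by
    intro k
    induction k using Nat.twoStepInduction with
    | zero =>
      rintro m rfl
      have a := hf m
      rw [spectralParam, show m + 2 = m + 0 + 2 by rfl, h1] at a
      simp only [Nat.add_zero] at h0
      rw [h0] at a
      simp only [jostPoly, Nat.add_zero, Nat.sub_zero]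
      linear_combination -a + z ^ m * hzz
    | one =>
      rintro m rfl
      have a := hf m
      have b := hf (m + 1)
      rw [h0] at a
      rw [show m + 1 + 2 = m + 1 + 2 by rfl, h0, h1] at b
      simp only [spectralParam] at a b
      simp only [jostPoly, Nat.sub_zero, show m + 1 + 1 - 1 = m + 1 by omega]
      generalize f m = A at *
      generalize f (m + 1) = B at *
      have hB : B = z ^ (m + 1) * (1 + v (m + 1 + 1) * z) := by
        linear_combination -b + z ^ (m + 1) * hzz
      rw [hB] at a
      linear_combination -a + z ^ m * (1 + v (m + 1 + 1) * z) * hzz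
    | more n i0 i1 =>
      intro m hm
      have a := hf m
      rw [i0 (m + 2) (by omega), i1 (m + 1) (by omega), spectralParam] at a
      simp only [jostPoly, show K + 1 - (n + 2) = m + 1 by omega]
      generalize jostPoly (fun k => v (K + 1 - k)) n z = A at *
      generalize jostPoly (fun k => v (K + 1 - k)) (n + 1) z = B at *
      linear_combination -a + z ^ m * B * hzz
  have hw := hf.wronskian (regularSolution_isSolution v (spectralParam z)) (K + 1)
  rw [h0, h1, ← jostFunction_eq_wronskian v (K + 1) hv hz (K + 1) le_rfl, hk K 0 (by omega)] at hw
  rw [hw]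
  simp [regularSolution]

theorem regularSolution_conj (v : ℕ → ℝ) (lam : ℂ) (j : ℕ) :
    (starRingEnd ℂ) (regularSolution v lam j) = regularSolution v ((starRingEnd ℂ) lam) j := by
  induction j using Nat.twoStepInduction with
  | zero => simp [regularSolution]
  | one => simp [regularSolution]
  | more n h0 h1 => simp [regularSolution, h0, h1, map_ofNat (starRingEnd ℂ) 2]

theorem jostFunction_conj (v : ℕ → ℝ) (z : ℂ) :
    (starRingEnd ℂ) (jostFunction v z) = jostFunction v ((starRingEnd ℂ) z) := by
  simp only [jostFunction, map_add, map_one, Complex.conj_tsum, map_mul, map_pow,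
    regularSolution_conj, Complex.conj_ofReal, spectralParam, map_sub, map_inv₀, map_ofNat]

theorem regularSolution_not_eventually_zero (v : ℕ → ℝ) (lam : ℂ) (J : ℕ)
    (h : ∀ n, J ≤ n → regularSolution v lam n = 0) : False := by
  have h0 : IsSolution v lam (fun _ => 0) := fun i => by simp
  have := IsSolution.ext_right (regularSolution_isSolution v lam) h0 (J + 1) (h _ (by omega))
    (h _ (by omega)) 1 (by omega)
  simp [regularSolution] at this

/-- A zero inside the disc makes φ decay geometrically, hence a bound state. On the circle, realness
of v makes 1/z a zero too, so that φ would have two distinct ratios and vanish. -/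
theorem jostFunction_ne_zero (v : ℕ → ℝ) (hsupp : ∃ J : ℕ, ∀ j : ℕ, J < j → v j = 0)
    (hbound : NoBoundStates v) (hone : jostFunction v 1 ≠ 0) (hneg : jostFunction v (-1) ≠ 0)
    (z : ℂ) (hz : ‖z‖ ≤ 1) : jostFunction v z ≠ 0 := by
  intro hF
  obtain ⟨J, hv⟩ := hsupp
  rcases eq_or_ne z 0 with rfl | hz0
  · simp [jostFunction_zero] at hF
  have step : ∀ w : ℂ, w ≠ 0 → jostFunction v w = 0 → ∀ n, J ≤ n →
      regularSolution v (spectralParam w) (n + 1) =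
        w * regularSolution v (spectralParam w) n := by
    intro w hw h n hn
    rw [jostFunction_eq_wronskian v J hv hw n hn] at h
    refine mul_left_cancel₀ (pow_ne_zero n hw) ?_
    linear_combination h
  have s1 := step z hz0 hF
  rcases hz.lt_or_eq with hlt | heq
  · have hg : ∀ k, regularSolution v (spectralParam z) (J + k) =
        z ^ k * regularSolution v (spectralParam z) J := by
      intro k
      induction k with
      | zero => simp
      | succ k ih => rw [← add_assoc, s1 _ (by omega), ih]; ring
    have hs : Summable fun j => ‖regularSolution v (spectralParam z) j‖ ^ 2 := by
      rw [← summable_nat_add_iff J]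
      have : Summable fun k : ℕ => (‖z‖ ^ 2) ^ k *
          ‖regularSolution v (spectralParam z) J‖ ^ 2 := by
        refine (summable_geometric_of_lt_one (by positivity) ?_).mul_right _
        exact pow_lt_one₀ (norm_nonneg _) hlt two_ne_zero
      refine this.congr fun k => ?_
      rw [add_comm k J, hg, norm_mul, norm_pow]
      ring
    have := congrFun (hbound _ _ rfl (regularSolution_isSolution v (spectralParam z)) hs) 1
    simp [regularSolution] at this
  · have hconj : (starRingEnd ℂ) z = z⁻¹ := by
      rw [Complex.inv_def, Complex.normSq_eq_norm_sq, heq]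
      simp
    have hF' : jostFunction v z⁻¹ = 0 := by
      rw [← hconj, ← jostFunction_conj, hF, map_zero]
    have s2 := step z⁻¹ (inv_ne_zero hz0) hF'
    have hs : spectralParam z⁻¹ = spectralParam z := by
      simp only [spectralParam, inv_inv]
      ring
    rw [hs] at s2
    have hne : z - z⁻¹ ≠ 0 := by
      intro h
      have hsq : z ^ 2 = 1 := by
        have := mul_inv_cancel₀ hz0
        linear_combination z * h + this
      rcases eq_or_eq_neg_of_sq_eq_sq z 1 (by rw [hsq, one_pow]) with rfl | rfl
      · exact hone hF
      · exact hneg hF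
    refine regularSolution_not_eventually_zero v (spectralParam z) J fun n hn => ?_
    refine (mul_eq_zero.mp ?_).resolve_left hne
    linear_combination s2 n hn - s1 n hn

/-! ### Factorisation of the Jost function -/

/-- Closure of the family under conjugation, with multiplicities, is recorded as invariance of all
sums, so that no permutation of indices has to be named. -/
theorem exists_jostFunction_eq_prod (v : ℕ → ℝ) (hsupp : ∃ J : ℕ, ∀ j : ℕ, J < j → v j = 0)
    (hbound : NoBoundStates v) (hone : jostFunction v 1 ≠ 0) (hneg : jostFunction v (-1) ≠ 0) :
    ∃ (n : ℕ) (a : Fin n → ℂ), (∀ i, ‖a i‖ < 1) ∧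
      (∀ z, jostFunction v z = ∏ i, (1 - a i * z)) ∧
      ∏ i, jostFunction v (a i) = ∏ i, (1 - a i ^ 2) ∧
      ∀ F : ℂ → ℂ, ∑ i, F ((starRingEnd ℂ) (a i)) = ∑ i, F (a i) := by
  have hnz := jostFunction_ne_zero v hsupp hbound hone hneg
  classical
  have hJ := Nat.find_spec hsupp
  have hmin : ∀ m, m < Nat.find hsupp → ¬ ∀ j : ℕ, m < j → v j = 0 :=
    fun m hm => Nat.find_min hsupp hm
  generalize Nat.find hsupp = J at hJ hmin
  -- The least J is used: for J = 0 only the irrelevant value v 0 may survive and F̂ = 1; otherwise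
  -- minimality gives v (K + 1) ≠ 0.
  rcases J with _ | K
  · refine ⟨0, Fin.elim0, fun i => i.elim0, fun z => ?_, by simp, by simp⟩
    rw [jostFunction_eq_sum v 0 hJ z 1 (by omega)]
    simp [regularSolution]
  set u : ℕ → ℝ := fun k => v (K + 1 - k) with hu
  have hu0 : u 0 ≠ 0 := by
    intro h
    refine hmin K (by omega) fun j hj => ?_
    rcases eq_or_ne j (K + 1) with rfl | hne
    · exact h
    · exact hJ j (by omega)
  have hjp : ∀ z, jostFunction v z = jostPoly u K z := jostFunction_eq_jostPoly v K hJ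
  set s := (reversedJostC u K).roots with hs
  obtain ⟨n, a, ha⟩ : ∃ (n : ℕ) (a : Fin n → ℂ), s = Finset.univ.val.map a := by
    refine ⟨s.toList.length, s.toList.get, ?_⟩
    conv_lhs => rw [← Multiset.coe_toList s, ← List.ofFn_get s.toList]
    simp [Fin.univ_val_map]
  have hprod : ∀ F : ℂ → ℂ, (s.map F).prod = ∏ i, F (a i) := by
    intro F
    rw [ha, Multiset.map_map]
    rfl
  have hsum : ∀ F : ℂ → ℂ, (s.map F).sum = ∑ i, F (a i) := by
    intro F
    rw [ha, Multiset.map_map]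
    rfl
  have hP : ∀ z, jostFunction v z = ∏ i, (1 - a i * z) := by
    intro z
    rw [hjp, jostPoly_eq_prod, hprod]
  refine ⟨n, a, fun i => ?_, hP, ?_, fun F => ?_⟩
  · by_contra! hlt
    have ha0 : a i ≠ 0 := by
      intro h
      rw [h, norm_zero] at hlt
      linarith
    refine hnz (a i)⁻¹ (by rw [norm_inv]; exact inv_le_one_of_one_le₀ hlt) ?_
    rw [hP]
    exact Finset.prod_eq_zero (Finset.mem_univ i) (by rw [mul_inv_cancel₀ ha0, sub_self])
  · have := jostPoly_prod_roots u hu0 K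
    rw [hprod, hprod] at this
    simp only [hjp]
    exact this
  · have h1 := hsum fun x => F ((starRingEnd ℂ) x)
    rw [← hsum F, ← h1, hs]
    conv_rhs => rw [← reversedJostC_roots_conj, Multiset.map_map]
    rfl

open Metric MeasureTheory

/-! ### Integrals over the unit circle -/

/-- The point `exp(iq)` of the unit circle. -/
def unitExp (q : ℝ) : ℂ := Complex.exp (Complex.I * q)

theorem unitExp_ne_zero (q : ℝ) : unitExp q ≠ 0 := Complex.exp_ne_zero _

theorem norm_unitExp (q : ℝ) : ‖unitExp q‖ = 1 := by
  rw [unitExp, mul_comm]; exact Complex.norm_exp_ofReal_mul_I q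

theorem unitExp_neg (q : ℝ) : unitExp (-q) = (unitExp q)⁻¹ := by
  rw [unitExp, unitExp, ← Complex.exp_neg]
  push_cast
  ring_nf

theorem conj_unitExp (q : ℝ) : (starRingEnd ℂ) (unitExp q) = unitExp (-q) := by
  rw [unitExp, unitExp, ← Complex.exp_conj]
  simp

theorem unitExp_add_two_pi (q : ℝ) : unitExp (q + 2 * Real.pi) = unitExp q := by
  rw [unitExp, unitExp]
  push_cast
  rw [mul_add, Complex.exp_add, mul_comm Complex.I (2 * _), Complex.exp_two_pi_mul_I, mul_one]

theorem continuous_unitExp : Continuous unitExp := by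
  unfold unitExp
  fun_prop

theorem hasDerivAt_unitExp (q : ℝ) : HasDerivAt unitExp (Complex.I * unitExp q) q := by
  have h : HasDerivAt (fun x : ℝ => Complex.I * (x : ℂ)) Complex.I q := by
    simpa using (Complex.ofRealCLM.hasDerivAt (x := q)).const_mul Complex.I
  have := h.cexp
  rwa [mul_comm] at this

theorem unitExp_add (q : ℝ) : unitExp q + unitExp (-q) = 2 * Real.cos q := by
  rw [unitExp, unitExp, Complex.ofReal_cos, Complex.two_cos]
  push_cast
  ring_nf

theorem unitExp_sub (q : ℝ) : unitExp q - unitExp (-q) = 2 * Complex.I * Real.sin q := by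
  have h2 : (2 : ℂ) * Complex.sin q = _ := Complex.two_sin (q : ℂ)
  rw [unitExp, unitExp, Complex.ofReal_sin]
  push_cast
  rw [show Complex.I * -(q : ℂ) = -q * Complex.I by ring, mul_comm Complex.I (q : ℂ)]
  linear_combination (-Complex.I) * h2 - (Complex.exp (-q * Complex.I) -
        Complex.exp (q * Complex.I)) * Complex.I_mul_I

theorem unitExp_mul_neg (q : ℝ) : unitExp q * unitExp (-q) = 1 := by
  rw [unitExp_neg, mul_inv_cancel₀ (unitExp_ne_zero q)]

theorem circleMap_eq_unitExp (q : ℝ) : circleMap 0 1 q = unitExp q := by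
  simp [circleMap, unitExp, mul_comm]

theorem unitExp_mem (q : ℝ) : unitExp q ∈ closedBall (0 : ℂ) 1 := by
  simp [norm_unitExp]

theorem integral_symm_of_periodic {g : ℝ → ℂ} (hg : Continuous g)
    (hp : Function.Periodic g (2 * Real.pi)) :
    ∫ q in (0 : ℝ)..Real.pi, (g q + g (-q)) = ∫ q in (0 : ℝ)..2 * Real.pi, g q := by
  have hg' : Continuous fun q => g (-q) := by fun_prop
  rw [intervalIntegral.integral_add (hg.intervalIntegrable _ _) (hg'.intervalIntegrable _ _),
    intervalIntegral.integral_comp_neg, neg_zero, add_comm,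
    intervalIntegral.integral_add_adjacent_intervals (hg.intervalIntegrable _ _)
      (hg.intervalIntegrable _ _)]
  have := hp.intervalIntegral_add_eq (-Real.pi) 0
  rw [zero_add, show -Real.pi + 2 * Real.pi = Real.pi by ring] at this
  exact this

section
variable {U : Set ℂ} {f : ℂ → ℂ}

theorem continuous_comp_unitExp (hsub : closedBall (0 : ℂ) 1 ⊆ U) (hf : DifferentiableOn ℂ f U) :
    Continuous fun q : ℝ => f (unitExp q) :=
  hf.continuousOn.comp_continuous continuous_unitExp fun q => hsub (unitExp_mem q)

/-- Mean value property on the circle, folded onto the half circle. It evaluates the angular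
integrals of analytic functions below. -/
theorem integral_unitExp_symm (hsub : closedBall (0 : ℂ) 1 ⊆ U) (hf : DifferentiableOn ℂ f U) :
    ∫ q in (0 : ℝ)..Real.pi, (f (unitExp q) + f (unitExp (-q))) = 2 * Real.pi * f 0 := by
  rw [integral_symm_of_periodic (g := fun q => f (unitExp q)) (continuous_comp_unitExp hsub hf)
    (fun q => by simp only [unitExp_add_two_pi])]
  have hd : DiffContOnCl ℂ f (ball 0 |1|) := by
    refine (hf.mono ?_).diffContOnCl
    rw [abs_one, closure_ball _ one_ne_zero]
    exact hsub
  have h := hd.circleAverage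
  rw [Real.circleAverage_def] at h
  simp only [circleMap_eq_unitExp, Complex.real_smul] at h
  rw [← h]
  push_cast
  have : (Real.pi : ℂ) ≠ 0 := by exact_mod_cast Real.pi_ne_zero
  field_simp
end

/-! ### The logarithm of a product over points of the unit disc -/

/-- The analytic logarithm of `∏ (1 - a_i z)`. -/
def logProd {n : ℕ} (a : Fin n → ℂ) (z : ℂ) : ℂ := ∑ i, Complex.log (1 - a i * z)

/-- The function `z L'(z)` for `L = logProd a`. -/
def eulerLogProd {n : ℕ} (a : Fin n → ℂ) (z : ℂ) : ℂ := ∑ i, -(a i * z) / (1 - a i * z)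

/-- A neighbourhood of the closed unit disc on which `logProd a` is analytic. -/
def logDomain {n : ℕ} (a : Fin n → ℂ) : Set ℂ := {z | ∀ i, ‖a i * z‖ < 1}

section
variable {n : ℕ} {a : Fin n → ℂ}

theorem isOpen_logDomain : IsOpen (logDomain a) := by
  simp only [logDomain, Set.ofPred_forall]
  exact isOpen_iInter_of_finite fun i => isOpen_lt (by fun_prop) continuous_const

theorem closedBall_subset_logDomain (ha : ∀ i, ‖a i‖ < 1) :
    closedBall (0 : ℂ) 1 ⊆ logDomain a := by
  intro z hz i
  rw [mem_closedBall_zero_iff] at hz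
  rw [norm_mul]
  calc ‖a i‖ * ‖z‖ ≤ ‖a i‖ * 1 := by gcongr
    _ < 1 := by simpa using ha i

theorem one_sub_mem_slitPlane {w : ℂ} (hw : ‖w‖ < 1) : 1 - w ∈ Complex.slitPlane := by
  rw [sub_eq_add_neg]
  exact Complex.mem_slitPlane_of_norm_lt_one (by rwa [norm_neg])

theorem one_sub_ne_zero {w : ℂ} (hw : ‖w‖ < 1) : 1 - w ≠ 0 :=
  Complex.slitPlane_ne_zero (one_sub_mem_slitPlane hw)

theorem hasDerivAt_logProd {z : ℂ} (hz : z ∈ logDomain a) :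
    HasDerivAt (logProd a) (∑ i, -a i / (1 - a i * z)) z := by
  unfold logProd
  refine HasDerivAt.fun_sum fun i _ => ?_
  have h : HasDerivAt (fun z => 1 - a i * z) (-a i) z := by
    simpa using ((hasDerivAt_id z).const_mul (a i)).const_sub 1
  exact h.clog (one_sub_mem_slitPlane (hz i))

theorem differentiableOn_logProd : DifferentiableOn ℂ (logProd a) (logDomain a) :=
  fun _ hz => (hasDerivAt_logProd hz).differentiableAt.differentiableWithinAt

theorem mul_deriv_logProd {z : ℂ} (hz : z ∈ logDomain a) :
    z * deriv (logProd a) z = eulerLogProd a z := by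
  rw [(hasDerivAt_logProd hz).deriv, eulerLogProd, Finset.mul_sum]
  exact Finset.sum_congr rfl fun i _ => by ring

theorem differentiableOn_eulerLogProd : DifferentiableOn ℂ (eulerLogProd a) (logDomain a) := by
  unfold eulerLogProd
  refine DifferentiableOn.fun_sum fun i _ => ?_
  refine DifferentiableOn.div (by fun_prop) (by fun_prop) fun z hz => one_sub_ne_zero (hz i)

theorem exp_logProd {z : ℂ} (hz : z ∈ logDomain a) :
    Complex.exp (logProd a z) = ∏ i, (1 - a i * z) := by
  rw [logProd, Complex.exp_sum]
  exact Finset.prod_congr rfl fun i _ => Complex.exp_log (one_sub_ne_zero (hz i))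

theorem logProd_zero : logProd a 0 = 0 := by simp [logProd]

theorem conj_log_one_sub {w : ℂ} (hw : ‖w‖ < 1) :
    (starRingEnd ℂ) (Complex.log (1 - w)) = Complex.log (1 - (starRingEnd ℂ) w) := by
  rw [← Complex.log_conj _ (Complex.slitPlane_arg_ne_pi (one_sub_mem_slitPlane hw))]
  simp

theorem conj_logProd (hc : ∀ F : ℂ → ℂ, ∑ i, F ((starRingEnd ℂ) (a i)) = ∑ i, F (a i)) {z : ℂ}
    (hz : z ∈ logDomain a) :
    (starRingEnd ℂ) (logProd a z) = logProd a ((starRingEnd ℂ) z) := by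
  rw [logProd, map_sum, logProd, ← hc fun x => Complex.log (1 - x * (starRingEnd ℂ) z)]
  exact Finset.sum_congr rfl fun i _ => by rw [conj_log_one_sub (hz i), map_mul]

theorem conj_eulerLogProd (hc : ∀ F : ℂ → ℂ, ∑ i, F ((starRingEnd ℂ) (a i)) = ∑ i, F (a i))
    (z : ℂ) : (starRingEnd ℂ) (eulerLogProd a z) = eulerLogProd a ((starRingEnd ℂ) z) := by
  rw [eulerLogProd, map_sum, eulerLogProd,
    ← hc fun x => -(x * (starRingEnd ℂ) z) / (1 - x * (starRingEnd ℂ) z)]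
  exact Finset.sum_congr rfl fun i _ => by simp

theorem dslope_mul_sub (f : ℂ → ℂ) (c z : ℂ) : (z - c) * dslope f c z = f z - f c :=
  sub_smul_dslope f c z

/-- The cross term of `L` and `z L'` over the circle. -/
theorem integral_logProd_mul_eulerLogProd (ha : ∀ i, ‖a i‖ < 1) :
    ∫ q in (0 : ℝ)..Real.pi, (logProd a (unitExp q) * eulerLogProd a (unitExp (-q)) +
      logProd a (unitExp (-q)) * eulerLogProd a (unitExp q)) =
      -(2 * Real.pi * ∑ i, logProd a (a i)) := by
  have hsub := closedBall_subset_logDomain ha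
  have hmem : ∀ i, a i ∈ logDomain a := fun i => hsub (by simpa using (ha i).le)
  -- With w = 1/z, -a_i w / (1 - a_i w) = -a_i / (z - a_i). Writing L(z) = (L(z) - L(a_i)) + L(a_i)
  -- splits L(z) · w L'(w) into a part analytic in z and a part analytic in w; `f` collects both, so
  -- the symmetrised cross term is f(z) + f(w).
  set f : ℂ → ℂ := fun w => ∑ i, (-(a i * dslope (logProd a) (a i) w) -
    logProd a (a i) * (a i * w / (1 - a i * w))) with hfdef
  have hf : DifferentiableOn ℂ f (logDomain a) := by
    refine DifferentiableOn.fun_sum fun i _ => ?_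
    have h1 : DifferentiableOn ℂ (dslope (logProd a) (a i)) (logDomain a) :=
      (Complex.differentiableOn_dslope (isOpen_logDomain.mem_nhds (hmem i))).mpr
        differentiableOn_logProd
    have h2 : DifferentiableOn ℂ (fun w => a i * w / (1 - a i * w)) (logDomain a) :=
      DifferentiableOn.div (by fun_prop) (by fun_prop) fun z hz => one_sub_ne_zero (hz i)
    exact ((h1.const_mul _).neg).sub (h2.const_mul _)
  have hf0 : f 0 = -∑ i, logProd a (a i) := by
    rw [hfdef, ← Finset.sum_neg_distrib]
    refine Finset.sum_congr rfl fun i _ => ?_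
    have := dslope_mul_sub (logProd a) (a i) 0
    rw [logProd_zero] at this
    linear_combination this
  have key : ∀ z w : ℂ, z ∈ logDomain a → w ∈ logDomain a → z * w = 1 →
      logProd a z * eulerLogProd a w + logProd a w * eulerLogProd a z = f z + f w := by
    intro z w hz hw hzw
    simp only [hfdef, eulerLogProd, Finset.mul_sum, ← Finset.sum_add_distrib]
    refine Finset.sum_congr rfl fun i _ => ?_
    have d1 := dslope_mul_sub (logProd a) (a i) z
    have d2 := dslope_mul_sub (logProd a) (a i) w
    have n1 := one_sub_ne_zero (hz i)
    have n2 := one_sub_ne_zero (hw i)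
    generalize dslope (logProd a) (a i) z = D1 at *
    generalize dslope (logProd a) (a i) w = D2 at *
    generalize logProd a (a i) = l at *
    have e1 : D1 * (1 - a i * w) = w * (logProd a z - l) := by
      linear_combination w * d1 - D1 * hzw
    have e2 : D2 * (1 - a i * z) = z * (logProd a w - l) := by
      linear_combination z * d2 - D2 * hzw
    rw [← eq_div_iff n2] at e1
    rw [← eq_div_iff n1] at e2
    rw [e1, e2]
    ring
  rw [← mul_neg, ← hf0, ← integral_unitExp_symm hsub hf]
  refine intervalIntegral.integral_congr fun q _ => ?_
  exact key _ _ (hsub (unitExp_mem _)) (hsub (unitExp_mem _)) (unitExp_mul_neg q)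

theorem circleIntegral_logProd (ha : ∀ i, ‖a i‖ < 1) :
    (2 * Real.pi * Complex.I)⁻¹ * (∮ z in C(0, 1), logProd a z⁻¹ * deriv (logProd a) z) =
      -∑ i, logProd a (a i) := by
  have hsub := closedBall_subset_logDomain ha
  have hL := continuous_comp_unitExp hsub (differentiableOn_logProd (a := a))
  have hA := continuous_comp_unitExp hsub (differentiableOn_eulerLogProd (a := a))
  have e : (∮ z in C(0, 1), logProd a z⁻¹ * deriv (logProd a) z) =
      Complex.I * ∫ q in (0 : ℝ)..2 * Real.pi,
        logProd a (unitExp (-q)) * eulerLogProd a (unitExp q) := by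
    rw [circleIntegral, ← intervalIntegral.integral_const_mul]
    refine intervalIntegral.integral_congr fun q _ => ?_
    simp only [deriv_circleMap, circleMap_eq_unitExp, smul_eq_mul]
    rw [← mul_deriv_logProd (hsub (unitExp_mem q)), unitExp_neg]
    ring
  have hs := integral_symm_of_periodic
    (g := fun q => logProd a (unitExp (-q)) * eulerLogProd a (unitExp q))
    ((hL.comp continuous_neg).mul hA) (fun q => by
      simp only [unitExp_add_two_pi]
      rw [unitExp_neg, unitExp_neg, unitExp_add_two_pi])
  rw [e, ← hs]
  have h := integral_logProd_mul_eulerLogProd ha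
  simp only [neg_neg, add_comm] at h ⊢
  rw [h]
  have h1 : (Real.pi : ℂ) ≠ 0 := by exact_mod_cast Real.pi_ne_zero
  have h2 := Complex.I_ne_zero
  field_simp

theorem logProd_one_add_neg_one (ha : ∀ i, ‖a i‖ < 1) :
    logProd a 1 + logProd a (-1) = ∑ i, Complex.log (1 - a i ^ 2) := by
  rw [logProd, logProd, ← Finset.sum_add_distrib]
  refine Finset.sum_congr rfl fun i _ => ?_
  -- Both factors 1 ∓ a_i lie in the right half-plane, so their arguments add without leaving the
  -- principal branch.
  have hre : ∀ w : ℂ, ‖w‖ < 1 → |(1 - w).arg| < Real.pi / 2 := by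
    intro w hw
    rw [Complex.abs_arg_lt_pi_div_two_iff]
    left
    have := (abs_le.mp (Complex.abs_re_le_norm w)).2
    simp
    linarith
  have h1 := abs_lt.mp (hre (a i * 1) (by simpa using ha i))
  have h2 := abs_lt.mp (hre (a i * -1) (by simpa using ha i))
  rw [← Complex.log_mul (one_sub_ne_zero (by simpa using ha i))
    (one_sub_ne_zero (by simpa using ha i)) ⟨by linarith, by linarith⟩]
  ring_nf

/-- The product identity equates the exponentials of the two sides; both sides are real by
conjugation symmetry, where the exponential is injective. -/
theorem logProd_constraint (ha : ∀ i, ‖a i‖ < 1)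
    (hc : ∀ F : ℂ → ℂ, ∑ i, F ((starRingEnd ℂ) (a i)) = ∑ i, F (a i))
    (hprod : ∏ i, ∏ j, (1 - a j * a i) = ∏ i, (1 - a i ^ 2)) :
    logProd a 1 + logProd a (-1) = ∑ i, logProd a (a i) := by
  have hsub := closedBall_subset_logDomain ha
  have hmem : ∀ i, a i ∈ logDomain a := fun i => hsub (by simpa using (ha i).le)
  have hsq : ∀ i, ‖a i ^ 2‖ < 1 := fun i => by
    rw [norm_pow]; exact pow_lt_one₀ (norm_nonneg _) (ha i) two_ne_zero
  rw [logProd_one_add_neg_one ha]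
  set A := ∑ i, Complex.log (1 - a i ^ 2) with hA
  set B := ∑ i, logProd a (a i) with hB
  have cA : (starRingEnd ℂ) A = A := by
    rw [hA, map_sum, ← hc fun x => Complex.log (1 - x ^ 2)]
    exact Finset.sum_congr rfl fun i _ => by rw [conj_log_one_sub (hsq i), map_pow]
  have cB : (starRingEnd ℂ) B = B := by
    rw [hB, map_sum, ← hc fun x => logProd a x]
    exact Finset.sum_congr rfl fun i _ => conj_logProd hc (hmem i)
  have eA : Complex.exp A = ∏ i, (1 - a i ^ 2) := by
    rw [hA, Complex.exp_sum]
    exact Finset.prod_congr rfl fun i _ => Complex.exp_log (one_sub_ne_zero (hsq i))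
  have eB : Complex.exp B = ∏ i, (1 - a i ^ 2) := by
    rw [hB, Complex.exp_sum, ← hprod]
    exact Finset.prod_congr rfl fun i _ => exp_logProd (hmem i)
  obtain ⟨x, hx⟩ := Complex.conj_eq_iff_real.mp cA
  obtain ⟨y, hy⟩ := Complex.conj_eq_iff_real.mp cB
  rw [← eB, hx, hy, ← Complex.ofReal_exp, ← Complex.ofReal_exp] at eA
  rw [hx, hy, Real.exp_injective (Complex.ofReal_injective eA)]

theorem circleIntegral_logProd_constraint (ha : ∀ i, ‖a i‖ < 1)
    (hc : ∀ F : ℂ → ℂ, ∑ i, F ((starRingEnd ℂ) (a i)) = ∑ i, F (a i))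
    (hprod : ∏ i, ∏ j, (1 - a j * a i) = ∏ i, (1 - a i ^ 2)) :
    logProd a 1 + logProd a (-1) + (2 * Real.pi * Complex.I)⁻¹ *
      (∮ z in C(0, 1), logProd a z⁻¹ * deriv (logProd a) z) = 0 := by
  rw [circleIntegral_logProd ha, logProd_constraint ha hc hprod, add_neg_cancel]

/-! ### Uniqueness of the logarithm -/

/-- Two branches differ by a multiple of 2πi, which continuity forces to be 0 near the origin; the
identity theorem extends this to the closed disc, derivatives on the boundary included. -/
theorem eqOn_deriv_of_exp_eq {L M : ℂ → ℂ} (hL : AnalyticOnNhd ℂ L (closedBall 0 1))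
    (hM : AnalyticOnNhd ℂ M (closedBall 0 1))
    (h : ∀ z ∈ closedBall (0 : ℂ) 1, Complex.exp (L z) = Complex.exp (M z)) (h0 : L 0 = M 0) :
    Set.EqOn L M (closedBall 0 1) ∧ Set.EqOn (deriv L) (deriv M) (closedBall 0 1) := by
  have hz0 : (0 : ℂ) ∈ closedBall (0 : ℂ) 1 := by simp
  have hconn : IsPreconnected (closedBall (0 : ℂ) 1) := (convex_closedBall 0 1).isPreconnected
  have hev : L =ᶠ[𝓝 0] M := by
    have hcont : ContinuousAt (fun z => L z - M z) 0 :=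
      (hL 0 hz0).continuousAt.sub (hM 0 hz0).continuousAt
    have hball : ball (0 : ℂ) 1 ∈ 𝓝 (0 : ℂ) := ball_mem_nhds _ one_pos
    have hsmall : ∀ᶠ z in 𝓝 (0 : ℂ), ‖L z - M z‖ < 1 := by
      have := hcont.norm
      refine this.eventually_lt continuousAt_const ?_
      simp [h0]
    filter_upwards [hball, hsmall] with z hz hlt
    obtain ⟨k, hk⟩ := Complex.exp_eq_exp_iff_exists_int.mp (h z (ball_subset_closedBall hz))
    have hk0 : k = 0 := by
      by_contra hne
      rw [hk, add_sub_cancel_left] at hlt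
      simp only [norm_mul, Complex.norm_intCast, Complex.norm_I, Complex.norm_real,
        Real.norm_eq_abs, abs_of_pos Real.pi_pos, Complex.norm_ofNat] at hlt
      have : (1 : ℝ) ≤ |(k : ℝ)| := by exact_mod_cast Int.one_le_abs hne
      nlinarith [Real.pi_gt_three]
    simpa [hk0] using hk
  exact ⟨hL.eqOn_of_preconnected_of_eventuallyEq hM hconn hz0 hev,
    hL.deriv.eqOn_of_preconnected_of_eventuallyEq hM.deriv hconn hz0 hev.deriv⟩

theorem isLogJost_logProd {v : ℕ → ℝ} (ha : ∀ i, ‖a i‖ < 1)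
    (hP : ∀ z, jostFunction v z = ∏ i, (1 - a i * z)) : IsLogJost v (logProd a) where
  analytic := (differentiableOn_logProd.analyticOnNhd isOpen_logDomain).mono
    (closedBall_subset_logDomain ha)
  exp_eq z hz := by rw [hP, exp_logProd (closedBall_subset_logDomain ha hz)]
  zero := logProd_zero

theorem IsLogJost.constraint {v : ℕ → ℝ} {L : ℂ → ℂ} (hL : IsLogJost v L)
    (ha : ∀ i, ‖a i‖ < 1) (hP : ∀ z, jostFunction v z = ∏ i, (1 - a i * z))
    (hc : ∀ F : ℂ → ℂ, ∑ i, F ((starRingEnd ℂ) (a i)) = ∑ i, F (a i))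
    (hprod : ∏ i, ∏ j, (1 - a j * a i) = ∏ i, (1 - a i ^ 2)) :
    L 1 + L (-1) + (2 * Real.pi * Complex.I)⁻¹ * (∮ z in C(0, 1), L z⁻¹ * deriv L z) = 0 := by
  have hM := isLogJost_logProd ha hP
  obtain ⟨h1, h2⟩ := eqOn_deriv_of_exp_eq hL.analytic hM.analytic
    (fun z hz => by rw [hL.exp_eq z hz, hM.exp_eq z hz]) (by rw [hL.zero, hM.zero])
  rw [h1 (by simp), h1 (by simp), circleIntegral.integral_congr zero_le_one
    (g := fun z => logProd a z⁻¹ * deriv (logProd a) z),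
    circleIntegral_logProd_constraint ha hc hprod]
  intro z hz
  have hz1 : ‖z‖ = 1 := by simpa using hz
  simp only
  rw [h1 (by simp [hz1]), h2 (by simp [hz1])]

end

/-! ### The spectral change of variables -/

/-- The pulled-back integrand `h` is asked to be continuous up to the endpoints, but to match only
inside. This yields integrability even where `F` is singular at 0 or 4. -/
theorem integral_spectral {s t : ℝ} (hs : 0 ≤ s) (hst : s ≤ t) (ht : t ≤ Real.pi) {F h : ℝ → ℝ}
    (hh : ContinuousOn h (Set.Icc s t))
    (he : ∀ q ∈ Set.Ioo s t, 2 * Real.sin q * F (2 - 2 * Real.cos q) = h q) :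
    IntervalIntegrable F volume (2 - 2 * Real.cos s) (2 - 2 * Real.cos t) ∧
      ∫ x in (2 - 2 * Real.cos s)..(2 - 2 * Real.cos t), F x = ∫ q in s..t, h q := by
  have hcos : ∀ x ∈ Set.Icc s t, x ∈ Set.Icc 0 Real.pi :=
    fun x hx => ⟨hs.trans hx.1, hx.2.trans ht⟩
  have hmono : StrictMonoOn (fun q : ℝ => 2 - 2 * Real.cos q) (Set.Icc s t) := by
    intro x hx y hy hxy
    have := Real.strictAntiOn_cos (hcos x hx) (hcos y hy) hxy
    simp only
    linarith
  have hcont : ContinuousOn (fun q : ℝ => 2 - 2 * Real.cos q) (Set.Icc s t) := by fun_prop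
  have himg : (fun q : ℝ => 2 - 2 * Real.cos q) '' Set.Ioo s t =
      Set.Ioo (2 - 2 * Real.cos s) (2 - 2 * Real.cos t) := by
    apply Set.Subset.antisymm
    · rintro _ ⟨q, hq, rfl⟩
      exact ⟨hmono (Set.left_mem_Icc.mpr hst) (Set.Ioo_subset_Icc_self hq) hq.1,
        hmono (Set.Ioo_subset_Icc_self hq) (Set.right_mem_Icc.mpr hst) hq.2⟩
    · exact intermediate_value_Ioo hst hcont
  have hle : 2 - 2 * Real.cos s ≤ 2 - 2 * Real.cos t :=
    hmono.monotoneOn (Set.left_mem_Icc.mpr hst) (Set.right_mem_Icc.mpr hst) hst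
  have hd : ∀ q ∈ Set.Ioo s t, HasDerivWithinAt (fun q : ℝ => 2 - 2 * Real.cos q)
      (2 * Real.sin q) (Set.Ioo s t) q := by
    intro q _
    have := ((Real.hasDerivAt_cos q).const_mul 2).const_sub 2
    simpa using this.hasDerivWithinAt
  have hinj := hmono.injOn.mono (Set.Ioo_subset_Icc_self (a := s) (b := t))
  have hcongr : Set.EqOn (fun q => |2 * Real.sin q| • F (2 - 2 * Real.cos q)) h (Set.Ioo s t) := by
    intro q hq
    have hsin : 0 ≤ Real.sin q :=
      Real.sin_nonneg_of_nonneg_of_le_pi (hs.trans hq.1.le) (hq.2.le.trans ht)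
    simp only
    rw [abs_of_nonneg (by positivity), smul_eq_mul, he q hq]
  have hint : IntegrableOn h (Set.Ioo s t) :=
    (hh.integrableOn_Icc).mono_set Set.Ioo_subset_Icc_self
  constructor
  · rw [intervalIntegrable_iff_integrableOn_Ioo_of_le hle, ← himg,
      integrableOn_image_iff_integrableOn_abs_deriv_smul measurableSet_Ioo hd hinj]
    exact hint.congr_fun hcongr.symm measurableSet_Ioo
  · rw [intervalIntegral.integral_of_le hle, intervalIntegral.integral_of_le hst,
      integral_Ioc_eq_integral_Ioo, integral_Ioc_eq_integral_Ioo, ← himg,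
      integral_image_eq_integral_abs_deriv_smul measurableSet_Ioo hd hinj]
    exact setIntegral_congr_fun measurableSet_Ioo hcongr

/-! ### The scattering phase -/

section
variable {n : ℕ} {a : Fin n → ℂ}

/-- The scattering phase `-Im L(exp(ip))` for `L = logProd a`. -/
def phase (a : Fin n → ℂ) (p : ℝ) : ℝ := -(logProd a (unitExp p)).im

/-- The derivative of the scattering phase. -/
def phaseDeriv (a : Fin n → ℂ) (p : ℝ) : ℝ := -(eulerLogProd a (unitExp p)).re

/-- Conjugation symmetry turns the imaginary part into a difference of values of L at z and 1/z, to
which the mean value property applies. -/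
theorem phase_eq (ha : ∀ i, ‖a i‖ < 1)
    (hc : ∀ F : ℂ → ℂ, ∑ i, F ((starRingEnd ℂ) (a i)) = ∑ i, F (a i)) (p : ℝ) :
    (phase a p : ℂ) = Complex.I / 2 * (logProd a (unitExp p) - logProd a (unitExp (-p))) := by
  rw [← conj_unitExp, ← conj_logProd hc (closedBall_subset_logDomain ha (unitExp_mem p)),
    Complex.sub_conj, phase]
  push_cast
  linear_combination (-((logProd a (unitExp p)).im : ℂ)) * Complex.I_mul_I

theorem phaseDeriv_eq (hc : ∀ F : ℂ → ℂ, ∑ i, F ((starRingEnd ℂ) (a i)) = ∑ i, F (a i)) (p : ℝ) :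
    (phaseDeriv a p : ℂ) =
      -(1 / 2) * (eulerLogProd a (unitExp p) + eulerLogProd a (unitExp (-p))) := by
  rw [← conj_unitExp, ← conj_eulerLogProd hc, Complex.add_conj, phaseDeriv]
  push_cast
  ring

theorem hasDerivAt_phase (ha : ∀ i, ‖a i‖ < 1) (p : ℝ) :
    HasDerivAt (phase a) (phaseDeriv a p) p := by
  have hmem := closedBall_subset_logDomain ha (unitExp_mem p)
  have h := (hasDerivAt_logProd hmem).comp p (hasDerivAt_unitExp p)
  have h2 := (Complex.imCLM.hasFDerivAt.comp_hasDerivAt p h).neg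
  refine h2.congr_deriv ?_
  rw [phaseDeriv, ← mul_deriv_logProd hmem, (hasDerivAt_logProd hmem).deriv]
  simp [Complex.mul_re, Complex.mul_im]
  ring

theorem continuous_phase (ha : ∀ i, ‖a i‖ < 1) : Continuous (phase a) :=
  continuous_iff_continuousAt.mpr fun p => (hasDerivAt_phase ha p).continuousAt

theorem isScatteringPhase_phase {v : ℕ → ℝ} (ha : ∀ i, ‖a i‖ < 1)
    (hP : ∀ z, jostFunction v z = ∏ i, (1 - a i * z))
    (hc : ∀ F : ℂ → ℂ, ∑ i, F ((starRingEnd ℂ) (a i)) = ∑ i, F (a i)) :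
    IsScatteringPhase v (phase a) where
  continuous := continuous_phase ha
  odd p := by
    have h1 := phase_eq ha hc p
    have h2 := phase_eq ha hc (-p)
    rw [neg_neg] at h2
    have : (phase a (-p) : ℂ) = -(phase a p : ℂ) := by rw [h1, h2]; ring
    exact_mod_cast this
  periodic p := by rw [phase, unitExp_add_two_pi, phase]
  polar p := by
    change jostFunction v (unitExp p) = (‖jostFunction v (unitExp p)‖ : ℂ) * _
    rw [hP, ← exp_logProd (closedBall_subset_logDomain ha (unitExp_mem p)), Complex.norm_exp,
      Complex.ofReal_exp, ← Complex.exp_add, phase]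
    congr 1
    conv_lhs => rw [← Complex.re_add_im (logProd a (unitExp p))]
    push_cast
    ring
end

/-- Two phases differ by a continuous function with values in 2πℤ, hence by a constant; oddness
makes it 0. -/
theorem IsScatteringPhase.unique {v : ℕ → ℝ} (hnz : ∀ z, ‖z‖ ≤ 1 → jostFunction v z ≠ 0)
    {η ξ : ℝ → ℝ} (hη : IsScatteringPhase v η) (hξ : IsScatteringPhase v ξ) : η = ξ := by
  set g : ℝ → ℝ := fun p => (η p - ξ p) / (2 * Real.pi) with hg
  have hgc : Continuous g := (hη.continuous.sub hξ.continuous).div_const _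
  have hint : ∀ p, ∃ k : ℤ, g p = k := by
    intro p
    have h1 := hη.polar p
    rw [hξ.polar p] at h1
    have hne : (‖jostFunction v (Complex.exp (Complex.I * p))‖ : ℂ) ≠ 0 := by
      rw [Complex.ofReal_ne_zero, norm_ne_zero_iff]
      exact hnz _ (norm_unitExp p).le
    have hnorm : ‖((‖jostFunction v (Complex.exp (Complex.I * p))‖ : ℂ) *
        Complex.exp (-(Complex.I * ξ p)))‖ = ‖jostFunction v (Complex.exp (Complex.I * p))‖ := by
      rw [← hξ.polar p]
    rw [hnorm] at h1
    obtain ⟨k, hk⟩ := Complex.exp_eq_exp_iff_exists_int.mp (mul_left_cancel₀ hne h1)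
    refine ⟨k, ?_⟩
    have hk' : ((η p - ξ p : ℝ) : ℂ) = ((k * (2 * Real.pi) : ℝ) : ℂ) := by
      push_cast
      refine mul_left_cancel₀ Complex.I_ne_zero ?_
      linear_combination hk
    have hk'' : η p - ξ p = k * (2 * Real.pi) := Complex.ofReal_injective hk'
    rw [hg]
    simp only
    rw [hk'', mul_div_cancel_right₀ _ (by positivity)]
  choose k hk using hint
  have hkc : Continuous k := by
    rw [Int.isClosedEmbedding_coe_real.isEmbedding.continuous_iff]
    exact hgc.congr hk
  have hconst : ∀ p, k p = k 0 := fun p =>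
    PreconnectedSpace.constant inferInstance hkc
  have h00 : ∀ {ζ : ℝ → ℝ}, IsScatteringPhase v ζ → ζ 0 = 0 := by
    intro ζ hζ
    have := hζ.odd 0
    rw [neg_zero] at this
    linarith
  have hg0 : g 0 = 0 := by simp [hg, h00 hη, h00 hξ]
  funext p
  have : g p = 0 := by rw [hk, hconst, ← hk, hg0]
  have hpi : (2 * Real.pi) ≠ 0 := by positivity
  rw [hg, div_eq_zero_iff, or_iff_left hpi] at this
  linarith

/-! ### The phase in the spectral parameter -/

theorem spectralPhase_two_sub (η : ℝ → ℝ) {q : ℝ} (h0 : 0 ≤ q) (h1 : q ≤ Real.pi) :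
    spectralPhase η (2 - 2 * Real.cos q) = η q := by
  rw [spectralPhase, show 1 - (2 - 2 * Real.cos q) / 2 = Real.cos q by ring, Real.arccos_cos h0 h1]

theorem exists_angle {x : ℝ} (hx : x ∈ Set.Ioo (0 : ℝ) 4) :
    Real.arccos (1 - x / 2) ∈ Set.Ioo 0 Real.pi ∧
      2 - 2 * Real.cos (Real.arccos (1 - x / 2)) = x := by
  have h1 : -1 < 1 - x / 2 := by linarith [hx.2]
  have h2 : 1 - x / 2 < 1 := by linarith [hx.1]
  refine ⟨⟨Real.arccos_pos.mpr h2, ?_⟩, ?_⟩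
  · refine lt_of_le_of_ne (Real.arccos_le_pi _) fun h => ?_
    have := Real.arccos_eq_pi.mp h
    linarith
  · rw [Real.cos_arccos h1.le h2.le]
    ring

theorem hasDerivAt_spectralPhase {η : ℝ → ℝ} {d q : ℝ} (hq : q ∈ Set.Ioo 0 Real.pi)
    (hη : HasDerivAt η d q) :
    HasDerivAt (spectralPhase η) (d / (2 * Real.sin q)) (2 - 2 * Real.cos q) := by
  have hsin : 0 < Real.sin q := Real.sin_pos_of_pos_of_lt_pi hq.1 hq.2
  have hc := Real.sin_sq_add_cos_sq q
  have e : 1 - (2 - 2 * Real.cos q) / 2 = Real.cos q := by ring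
  have h1 : HasDerivAt (fun x : ℝ => 1 - x / 2) (-(1 / 2)) (2 - 2 * Real.cos q) := by
    simpa using ((hasDerivAt_id (2 - 2 * Real.cos q)).div_const 2).const_sub 1
  have h2 : HasDerivAt Real.arccos (-(1 / Real.sin q)) (1 - (2 - 2 * Real.cos q) / 2) := by
    have := Real.hasDerivAt_arccos (x := 1 - (2 - 2 * Real.cos q) / 2)
      (by rw [e]; nlinarith) (by rw [e]; nlinarith)
    refine this.congr_deriv ?_
    rw [e, show 1 - Real.cos q ^ 2 = Real.sin q ^ 2 by linarith, Real.sqrt_sq hsin.le]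
  have h3 := HasDerivAt.comp (h₂ := Real.arccos) (h := fun x : ℝ => 1 - x / 2) _ h2 h1
  have h4 : HasDerivAt η d ((Real.arccos ∘ fun x : ℝ => 1 - x / 2) (2 - 2 * Real.cos q)) := by
    simp only [Function.comp, e, Real.arccos_cos hq.1.le hq.2.le]
    exact hη
  have h5 := HasDerivAt.comp (h₂ := η) (h := Real.arccos ∘ fun x : ℝ => 1 - x / 2) _ h4 h3
  refine h5.congr_deriv ?_
  field_simp

section
variable {n : ℕ} {a : Fin n → ℂ}

/-! ### The integral of the phase against the cotangent -/

/-- The zeros of sin at 0 and π are cancelled by dividing L twice, at z = 1 and z = -1. The quotient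
is f(z) + f(1/z) minus a multiple of cos q; the latter integrates to 0, and f(0) is found by
evaluating the expansion of L at 0 and -1. -/
theorem exists_phase_mul_cot (ha : ∀ i, ‖a i‖ < 1)
    (hc : ∀ F : ℂ → ℂ, ∑ i, F ((starRingEnd ℂ) (a i)) = ∑ i, F (a i)) :
    ∃ h : ℝ → ℝ, Continuous h ∧
      (∀ q ∈ Set.Ioo 0 Real.pi, phase a q * Real.cos q / Real.sin q = h q) ∧
      ((∫ q in (0 : ℝ)..Real.pi, h q : ℝ) : ℂ) =
        -(Real.pi / 2) * (logProd a 1 + logProd a (-1)) := by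
  have hsub := closedBall_subset_logDomain ha
  have hL := differentiableOn_logProd (a := a)
  have h1 : (1 : ℂ) ∈ logDomain a := hsub (by simp)
  have h2 : (-1 : ℂ) ∈ logDomain a := hsub (by simp)
  set D := dslope (logProd a) 1 with hD
  set M := dslope D (-1) with hM
  have hDd : DifferentiableOn ℂ D (logDomain a) :=
    (Complex.differentiableOn_dslope (isOpen_logDomain.mem_nhds h1)).mpr hL
  have hMd : DifferentiableOn ℂ M (logDomain a) :=
    (Complex.differentiableOn_dslope (isOpen_logDomain.mem_nhds h2)).mpr hDd
  set f : ℂ → ℂ := fun z => -(1 / 2) * (M z * (z ^ 2 + 1)) with hf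
  have hfd : DifferentiableOn ℂ f (logDomain a) :=
    (hMd.mul (by fun_prop)).const_mul _
  set b := D (-1) with hb
  have hexp : ∀ z, logProd a z = logProd a 1 + (z - 1) * (b + (z + 1) * M z) := by
    intro z
    have e1 := dslope_mul_sub (logProd a) 1 z
    have e2 := dslope_mul_sub D (-1) z
    rw [← hD] at e1
    rw [← hM, ← hb] at e2
    linear_combination -e1 - (z - 1) * e2
  set H : ℝ → ℂ := fun q => (f (unitExp q) + f (unitExp (-q))) - b * Real.cos q with hH
  have hfc := continuous_comp_unitExp hsub hfd
  have hfc' : Continuous fun q : ℝ => f (unitExp (-q)) := hfc.comp continuous_neg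
  have hcos : Continuous fun q : ℝ => b * (Real.cos q : ℂ) := by fun_prop
  have hHc : Continuous H := (hfc.add hfc').sub hcos
  have key : ∀ q, (phase a q : ℂ) * Real.cos q = H q * Real.sin q := by
    intro q
    have ec := unitExp_add q
    have es := unitExp_sub q
    have em := unitExp_mul_neg q
    rw [phase_eq ha hc, hH, hf]
    simp only
    rw [hexp (unitExp q), hexp (unitExp (-q))]
    generalize unitExp q = z at *
    generalize unitExp (-q) = w at *
    generalize M z = Mz
    generalize M w = Mw
    have ec' : ((Real.cos q : ℝ) : ℂ) = (z + w) / 2 := by rw [ec]; ring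
    have es' : ((Real.sin q : ℝ) : ℂ) = -Complex.I * (z - w) / 2 := by
      rw [es]
      linear_combination ((Real.sin q : ℝ) : ℂ) * Complex.I_mul_I
    rw [ec', es']
    linear_combination (Complex.I / 4) * (Mz * z - Mw * w + Mz * z  - Mw * w) * em
  have hcongr : ∀ q ∈ Set.Ioo 0 Real.pi,
      ((phase a q * Real.cos q / Real.sin q : ℝ) : ℂ) = H q := by
    intro q hq
    have hsin : ((Real.sin q : ℝ) : ℂ) ≠ 0 := by
      exact_mod_cast (Real.sin_pos_of_pos_of_lt_pi hq.1 hq.2).ne'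
    rw [Complex.ofReal_div, Complex.ofReal_mul, div_eq_iff hsin, key]
  have hreal : ∀ q ∈ Set.Icc 0 Real.pi, ((H q).re : ℂ) = H q := by
    have hcl : Set.EqOn (fun q => ((H q).re : ℂ)) H (closure (Set.Ioo 0 Real.pi)) := by
      refine Set.EqOn.closure (fun q hq => ?_)
        (Complex.continuous_ofReal.comp (Complex.continuous_re.comp hHc)) hHc
      rw [← hcongr q hq, Complex.ofReal_re]
    rwa [closure_Ioo Real.pi_ne_zero.symm] at hcl
  refine ⟨fun q => (H q).re, Complex.continuous_re.comp hHc, fun q hq => ?_, ?_⟩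
  · change _ = (H q).re
    rw [← hcongr q hq, Complex.ofReal_re]
  rw [← intervalIntegral.integral_ofReal, intervalIntegral.integral_congr (g := H)]
  · have hs := intervalIntegral.integral_sub
      ((hfc.add hfc').intervalIntegrable (μ := volume) 0 Real.pi)
      (hcos.intervalIntegrable (μ := volume) 0 Real.pi)
    simp only [Pi.add_apply] at hs
    simp only [hH]
    rw [hs, integral_unitExp_symm hsub hfd, intervalIntegral.integral_const_mul,
      intervalIntegral.integral_ofReal, integral_cos]
    have e0 := hexp 0
    have e1 := hexp (-1)
    rw [logProd_zero] at e0
    rw [e1, hf]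
    simp only [Real.sin_pi, Real.sin_zero, sub_zero, Complex.ofReal_zero]
    linear_combination (-Real.pi : ℂ) * e0
  · intro q hq
    rw [Set.uIcc_of_le Real.pi_pos.le] at hq
    exact hreal q hq

/-! ### The principal value integral -/

/-- The sum `∑ a_i / (1 - 2 a_i cos p + a_i ^ 2)`. -/
def kernelSum (a : Fin n → ℂ) (p : ℝ) : ℂ :=
  ∑ i, a i / ((1 - a i * unitExp p) * (1 - a i * unitExp (-p)))

theorem one_sub_mul_unitExp_ne_zero (ha : ∀ i, ‖a i‖ < 1) (i : Fin n) (p : ℝ) :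
    1 - a i * unitExp p ≠ 0 :=
  one_sub_ne_zero (closedBall_subset_logDomain ha (unitExp_mem p) i)

theorem continuous_kernelSum (ha : ∀ i, ‖a i‖ < 1) : Continuous (kernelSum a) := by
  unfold kernelSum
  have := continuous_unitExp
  refine continuous_finsetSum _ fun i _ => Continuous.div (by fun_prop) (by fun_prop) fun p => ?_
  exact mul_ne_zero (one_sub_mul_unitExp_ne_zero ha i p) (one_sub_mul_unitExp_ne_zero ha i (-p))

theorem conj_kernelSum (hc : ∀ F : ℂ → ℂ, ∑ i, F ((starRingEnd ℂ) (a i)) = ∑ i, F (a i))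
    (p : ℝ) : (starRingEnd ℂ) (kernelSum a p) = kernelSum a p := by
  rw [kernelSum, map_sum,
    ← hc fun x => x / ((1 - x * unitExp p) * (1 - x * unitExp (-p)))]
  refine Finset.sum_congr rfl fun i _ => ?_
  simp only [map_div₀, map_mul, map_sub, map_one, conj_unitExp, neg_neg]
  rw [mul_comm (1 - _)]

/-- Absorbs the Jacobian 2 sin p of the spectral variable, turning the principal-value kernel into
values of z L'. -/
theorem sin_mul_kernelSum (ha : ∀ i, ‖a i‖ < 1) (p : ℝ) :
    2 * Complex.I * Real.sin p * kernelSum a p =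
      eulerLogProd a (unitExp (-p)) - eulerLogProd a (unitExp p) := by
  rw [← unitExp_sub, kernelSum, eulerLogProd, eulerLogProd, Finset.mul_sum,
    ← Finset.sum_sub_distrib]
  refine Finset.sum_congr rfl fun i _ => ?_
  have h1 := one_sub_mul_unitExp_ne_zero ha i p
  have h2 := one_sub_mul_unitExp_ne_zero ha i (-p)
  generalize unitExp p = z at *
  generalize unitExp (-p) = w at *
  generalize a i = α at *
  rw [div_sub_div _ _ h2 h1, mul_div_assoc', div_eq_div_iff (mul_ne_zero h1 h2) (mul_ne_zero h2 h1)]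
  ring

/-- The difference quotient of the derivative of the phase, as a function of `cos q`. -/
theorem exists_phaseDeriv_quotient (ha : ∀ i, ‖a i‖ < 1)
    (hc : ∀ F : ℂ → ℂ, ∑ i, F ((starRingEnd ℂ) (a i)) = ∑ i, F (a i)) (p : ℝ) :
    ∃ d : ℝ → ℝ, Continuous d ∧
      (∀ q, phaseDeriv a q - phaseDeriv a p = (Real.cos q - Real.cos p) * d q) ∧
      ∫ q in (0 : ℝ)..Real.pi, d q = Real.pi * (kernelSum a p).re := by
  have hsub := closedBall_subset_logDomain ha
  set k : Fin n → ℂ := fun i => a i / ((1 - a i * unitExp p) * (1 - a i * unitExp (-p))) with hk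
  -- The derivative of the phase is a constant plus half the sum of the Poisson-type kernels (1 -
  -- a²)/(1 - 2a cos q + a²). The difference quotient of such a kernel in cos q is a multiple of the
  -- kernel itself, and 1/(1 - a z) - 1/2 is its analytic half.
  set f : ℂ → ℂ := fun w => ∑ i, k i * (1 / (1 - a i * w) - 1 / 2) with hf
  have hfd : DifferentiableOn ℂ f (logDomain a) := by
    refine DifferentiableOn.fun_sum fun i _ => ?_
    refine ((DifferentiableOn.div (by fun_prop) (by fun_prop) fun z hz => ?_).sub_const _).const_mul _
    exact one_sub_ne_zero (hz i)
  have hfc := continuous_comp_unitExp hsub hfd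
  have hfc' : Continuous fun q : ℝ => f (unitExp (-q)) := hfc.comp continuous_neg
  refine ⟨fun q => (f (unitExp q) + f (unitExp (-q))).re,
    Complex.continuous_re.comp (hfc.add hfc'), fun q => ?_, ?_⟩
  · have h : ((phaseDeriv a q - phaseDeriv a p : ℝ) : ℂ) =
        ((Real.cos q - Real.cos p : ℝ) : ℂ) * (f (unitExp q) + f (unitExp (-q))) := by
      have e1 := unitExp_add q
      have e2 := unitExp_add p
      have m1 := unitExp_mul_neg q
      have m2 := unitExp_mul_neg p
      have e : ((Real.cos q - Real.cos p : ℝ) : ℂ) =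
          (unitExp q + unitExp (-q) - (unitExp p + unitExp (-p))) / 2 := by
        rw [e1, e2]
        push_cast
        ring
      rw [e]
      push_cast
      rw [phaseDeriv_eq hc, phaseDeriv_eq hc, hf]
      simp only [eulerLogProd, ← Finset.sum_add_distrib, Finset.mul_sum, ← Finset.sum_sub_distrib]
      refine Finset.sum_congr rfl fun i _ => ?_
      have n1 := one_sub_mul_unitExp_ne_zero ha i q
      have n2 := one_sub_mul_unitExp_ne_zero ha i (-q)
      have n3 := one_sub_mul_unitExp_ne_zero ha i p
      have n4 := one_sub_mul_unitExp_ne_zero ha i (-p)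
      rw [hk]
      simp only
      have hw : unitExp (-q) = (unitExp q)⁻¹ := unitExp_neg q
      have hw' : unitExp (-p) = (unitExp p)⁻¹ := unitExp_neg p
      have z1 := unitExp_ne_zero q
      have z2 := unitExp_ne_zero p
      generalize unitExp q = z at *
      generalize unitExp (-q) = w at *
      generalize unitExp p = s at *
      generalize unitExp (-p) = t at *
      generalize a i = α at *
      have red : ∀ x y : ℂ, x * y = 1 → 1 - α * x ≠ 0 → 1 - α * y ≠ 0 →
          -(α * x) / (1 - α * x) + -(α * y) / (1 - α * y) =
            1 - (1 - α ^ 2) / ((1 - α * x) * (1 - α * y)) := by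
        intro x y hxy hx hy
        field_simp
        linear_combination α ^ 2 * hxy
      have red2 : 1 / (1 - α * z) - 1 / 2 + (1 / (1 - α * w) - 1 / 2) =
          (1 - α ^ 2) / ((1 - α * z) * (1 - α * w)) := by
        field_simp
        linear_combination (-2 * α ^ 2) * m1
      rw [red z w m1 n1 n2, red s t m2 n3 n4]
      rw [← mul_add, red2]
      field_simp
      linear_combination (1 - α ^ 2) * α ^ 2 * (m2 - m1)
    have := congrArg Complex.re h
    rwa [Complex.ofReal_re, Complex.re_ofReal_mul] at this
  · have hi := integral_unitExp_symm hsub hfd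
    have hre := Complex.reCLM.intervalIntegral_comp_comm
      ((hfc.add hfc').intervalIntegrable (μ := volume) 0 Real.pi)
    simp only [Complex.reCLM_apply, Pi.add_apply] at hre
    rw [hre, hi]
    have : 2 * (Real.pi : ℂ) * f 0 = (Real.pi : ℝ) * kernelSum a p := by
      rw [hf, kernelSum, mul_assoc, mul_left_comm, Finset.mul_sum]
      congr 1
      refine Finset.sum_congr rfl fun i _ => ?_
      rw [hk]
      simp only
      ring
    rw [this, Complex.re_ofReal_mul]

/-- The primitive is log |sin((q - p)/2) / sin((q + p)/2)| / sin p, rewritten by half-angle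
formulas. Since `Real.log` is even, one formula serves on both sides of q = p. -/
theorem hasDerivAt_logKernel {p q : ℝ} (hp : Real.sin p ≠ 0) (h1 : Real.cos p - Real.cos q ≠ 0)
    (h2 : 1 - Real.cos (p + q) ≠ 0) :
    HasDerivAt (fun q => (Real.log (Real.cos p - Real.cos q) - Real.log (1 - Real.cos (p + q))) /
      Real.sin p) (1 / (Real.cos p - Real.cos q)) q := by
  have d1 : HasDerivAt (fun q => Real.cos p - Real.cos q) (Real.sin q) q := by
    simpa using (Real.hasDerivAt_cos q).const_sub (Real.cos p)
  have d2 : HasDerivAt (fun q => 1 - Real.cos (p + q)) (Real.sin (p + q)) q := by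
    have := (((hasDerivAt_id q).const_add p).cos).const_sub 1
    simpa using this
  refine (((d1.log h1).sub (d2.log h2)).div_const (Real.sin p)).congr_deriv ?_
  rw [Real.cos_add] at h2
  rw [Real.sin_add, Real.cos_add]
  have s1 := Real.sin_sq_add_cos_sq p
  have s2 := Real.sin_sq_add_cos_sq q
  rw [div_sub_div _ _ h1 h2, div_div,
    div_eq_div_iff (mul_ne_zero (mul_ne_zero h1 h2) hp) h1]
  linear_combination (Real.cos p - Real.cos q) * (-Real.sin q * s1 + Real.sin p * s2)

theorem integral_inv_cos_sub {p s t : ℝ} (hp : p ∈ Set.Ioo 0 Real.pi) (hst : s ≤ t)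
    (hs : 0 ≤ s) (ht : t ≤ Real.pi) (h : p ∉ Set.Icc s t) :
    ∫ q in s..t, 1 / (Real.cos p - Real.cos q) =
      (Real.log (Real.cos p - Real.cos t) - Real.log (1 - Real.cos (p + t))) / Real.sin p -
      (Real.log (Real.cos p - Real.cos s) - Real.log (1 - Real.cos (p + s))) / Real.sin p := by
  have hne : ∀ q ∈ Set.uIcc s t, Real.cos p - Real.cos q ≠ 0 := by
    intro q hq h0
    rw [Set.uIcc_of_le hst] at hq
    have := Real.injOn_cos (Set.Ioo_subset_Icc_self hp) ⟨hs.trans hq.1, hq.2.trans ht⟩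
      (sub_eq_zero.mp h0)
    exact h (this ▸ hq)
  refine intervalIntegral.integral_eq_sub_of_hasDerivAt
    (f := fun q => (Real.log (Real.cos p - Real.cos q) - Real.log (1 - Real.cos (p + q))) /
      Real.sin p) (fun q hq => ?_) ?_
  · refine hasDerivAt_logKernel (Real.sin_pos_of_pos_of_lt_pi hp.1 hp.2).ne' (hne q hq) ?_
    rw [Set.uIcc_of_le hst] at hq
    intro h0
    have hc : Real.cos (p + q) = 1 := by linarith
    rw [Real.cos_eq_one_iff_of_lt_of_lt (by linarith [hp.1, hq.1, Real.pi_pos])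
      (by linarith [hp.2, hq.2])] at hc
    linarith [hp.1, hq.1]
  · refine ContinuousOn.intervalIntegrable ?_
    exact ContinuousOn.div (by fun_prop) (by fun_prop) hne

end

section
variable {n : ℕ} {a : Fin n → ℂ}

theorem deriv_spectralPhase_phase (ha : ∀ i, ‖a i‖ < 1) {q : ℝ} (hq : q ∈ Set.Ioo 0 Real.pi) :
    deriv (spectralPhase (phase a)) (2 - 2 * Real.cos q) = phaseDeriv a q / (2 * Real.sin q) :=
  (hasDerivAt_spectralPhase hq (hasDerivAt_phase ha q)).deriv

/-- In the angle, the integrand is half of η'(p)/(cos p - cos q) minus a continuous quotient d(q).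
The singular part contributes nothing to the principal value, and the integral of d is known. -/
theorem hasPrincipalValue_deriv_phase (ha : ∀ i, ‖a i‖ < 1)
    (hc : ∀ F : ℂ → ℂ, ∑ i, F ((starRingEnd ℂ) (a i)) = ∑ i, F (a i)) {x : ℝ}
    (hx : x ∈ Set.Ioo (0 : ℝ) 4) :
    HasPrincipalValue (fun y : ℝ => deriv (spectralPhase (phase a)) y / (y - x)) 0 4 x
      (-(Real.pi / 2) * (kernelSum a (Real.arccos (1 - x / 2))).re) := by
  obtain ⟨hp, hpx⟩ := exists_angle hx
  set θ : ℝ → ℝ := fun y => Real.arccos (1 - y / 2) with hθ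
  have hθc : Continuous θ := Real.continuous_arccos.comp (by fun_prop)
  change θ x ∈ _ at hp
  set p := θ x with hpdef
  change 2 - 2 * Real.cos p = x at hpx
  change HasPrincipalValue _ 0 4 x (-(Real.pi / 2) * (kernelSum a p).re)
  have hsin : 0 < Real.sin p := Real.sin_pos_of_pos_of_lt_pi hp.1 hp.2
  obtain ⟨d, hdc, hd, hdi⟩ := exists_phaseDeriv_quotient ha hc p
  set F : ℝ → ℝ := fun y => deriv (spectralPhase (phase a)) y / (y - x) with hF
  set T : ℝ → ℝ := fun q =>
    (Real.log (Real.cos p - Real.cos q) - Real.log (1 - Real.cos (p + q))) / Real.sin p with hT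
  -- The primitive vanishes at both endpoints, so only the cut-off points around p contribute.
  have hT0 : T 0 = 0 := by
    simp only [hT, Real.cos_zero, add_zero]
    rw [← Real.log_neg_eq_log, neg_sub, sub_self, zero_div]
  have hTpi : T Real.pi = 0 := by
    simp only [hT, Real.cos_pi, Real.cos_add_pi]
    rw [sub_neg_eq_add, sub_neg_eq_add, add_comm, sub_self, zero_div]
  have piece : ∀ s t, 0 ≤ s → s ≤ t → t ≤ Real.pi → p ∉ Set.Icc s t →
      IntervalIntegrable F volume (2 - 2 * Real.cos s) (2 - 2 * Real.cos t) ∧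
      ∫ y in (2 - 2 * Real.cos s)..(2 - 2 * Real.cos t), F y =
        phaseDeriv a p / 2 * (T t - T s) - 1 / 2 * ∫ q in s..t, d q := by
    intro s t hs hst ht hpst
    have hne : ∀ q ∈ Set.Icc s t, Real.cos p - Real.cos q ≠ 0 := by
      intro q hq h0
      have := Real.injOn_cos (Set.Ioo_subset_Icc_self hp) ⟨hs.trans hq.1, hq.2.trans ht⟩
        (sub_eq_zero.mp h0)
      exact hpst (this ▸ hq)
    have hcont : ContinuousOn (fun q => 1 / (Real.cos p - Real.cos q)) (Set.Icc s t) :=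
      ContinuousOn.div (by fun_prop) (by fun_prop) hne
    have h := integral_spectral hs hst ht (F := F)
      (h := fun q => phaseDeriv a p / 2 * (1 / (Real.cos p - Real.cos q)) - 1 / 2 * d q)
      ((hcont.const_mul _).sub (hdc.continuousOn.const_mul _)) (by
        intro q hq
        have hq' : q ∈ Set.Ioo 0 Real.pi := ⟨hs.trans_lt hq.1, hq.2.trans_le ht⟩
        have hsq := (Real.sin_pos_of_pos_of_lt_pi hq'.1 hq'.2).ne'
        have hn := hne q (Set.Ioo_subset_Icc_self hq)
        have e := hd q
        simp only [hF]
        rw [deriv_spectralPhase_phase ha hq', ← hpx,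
          show 2 - 2 * Real.cos q - (2 - 2 * Real.cos p) = 2 * (Real.cos p - Real.cos q) by ring]
        have e' : phaseDeriv a q = phaseDeriv a p - (Real.cos p - Real.cos q) * d q := by
          linear_combination e
        rw [e']
        generalize Real.cos p - Real.cos q = c at *
        field_simp)
    refine ⟨h.1, ?_⟩
    rw [h.2, intervalIntegral.integral_sub
      (((hcont.const_mul _).mono (by rw [Set.uIcc_of_le hst])).intervalIntegrable)
      ((hdc.const_mul _).intervalIntegrable _ _), intervalIntegral.integral_const_mul,
      intervalIntegral.integral_const_mul, integral_inv_cos_sub hp hst hs ht hpst]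
  have hsmall : ∀ᶠ ε in 𝓝[>] (0 : ℝ), 0 < ε ∧ x - ε ∈ Set.Ioo (0 : ℝ) 4 ∧
      x + ε ∈ Set.Ioo (0 : ℝ) 4 := by
    have h1 : ∀ᶠ ε in 𝓝[>] (0 : ℝ), ε < min x (4 - x) :=
      eventually_nhdsWithin_of_eventually_nhds
        (eventually_lt_nhds (lt_min hx.1 (by linarith [hx.2])))
    filter_upwards [h1, self_mem_nhdsWithin] with ε h1 h2
    have h2' : 0 < ε := h2
    have h3 := lt_min_iff.mp h1
    exact ⟨h2', ⟨by linarith, by linarith [hx.2]⟩, ⟨by linarith [hx.1], by linarith⟩⟩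
  have left : ∀ ε, 0 < ε → x - ε ∈ Set.Ioo (0 : ℝ) 4 →
      IntervalIntegrable F volume 0 (x - ε) ∧ ∫ y in (0 : ℝ)..(x - ε), F y =
        phaseDeriv a p / 2 * T (θ (x - ε)) - 1 / 2 * ∫ q in (0 : ℝ)..θ (x - ε), d q := by
    intro ε hε hxε
    obtain ⟨hq, hqx⟩ := exists_angle hxε
    change θ (x - ε) ∈ _ at hq
    change 2 - 2 * Real.cos (θ (x - ε)) = x - ε at hqx
    have h := piece 0 (θ (x - ε)) le_rfl hq.1.le hq.2.le (by
      rintro ⟨_, h⟩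
      have := Real.cos_le_cos_of_nonneg_of_le_pi hp.1.le hq.2.le h
      linarith)
    rwa [hqx, hT0, sub_zero, Real.cos_zero, mul_one, sub_self] at h
  have right : ∀ ε, 0 < ε → x + ε ∈ Set.Ioo (0 : ℝ) 4 →
      IntervalIntegrable F volume (x + ε) 4 ∧ ∫ y in (x + ε)..4, F y =
        phaseDeriv a p / 2 * (-T (θ (x + ε))) - 1 / 2 * ∫ q in θ (x + ε)..Real.pi, d q := by
    intro ε hε hxε
    obtain ⟨hq, hqx⟩ := exists_angle hxε
    change θ (x + ε) ∈ _ at hq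
    change 2 - 2 * Real.cos (θ (x + ε)) = x + ε at hqx
    have h := piece (θ (x + ε)) Real.pi hq.1.le hq.2.le le_rfl (by
      rintro ⟨h, _⟩
      have := Real.cos_le_cos_of_nonneg_of_le_pi hq.1.le hp.2.le h
      linarith)
    rwa [hqx, hTpi, zero_sub, Real.cos_pi, show (2 : ℝ) - 2 * -1 = 4 by norm_num] at h
  refine ⟨hsmall.mono fun ε h => ⟨(left ε h.1 h.2.1).1, (right ε h.1 h.2.2).1⟩, ?_⟩
  set R : ℝ → ℝ := fun q => Real.log (1 - Real.cos (p + q)) with hR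
  set G : ℝ → ℝ := fun q => ∫ s in (0 : ℝ)..q, d s with hG
  have hGc : Continuous G :=
    intervalIntegral.continuous_primitive (fun _ _ => hdc.intervalIntegrable _ _) 0
  have hRc : ContinuousAt R p := by
    have h1 : 1 - Real.cos (p + p) ≠ 0 := by
      rw [← two_mul, Real.cos_two_mul']
      nlinarith [Real.sin_sq_add_cos_sq p]
    exact ContinuousAt.log (by fun_prop) h1
  -- What remains after the divergent logarithms cancel: a function of ε continuous at 0, whose
  -- value there is the principal value.
  set Φ : ℝ → ℝ := fun ε => phaseDeriv a p / 2 * ((R (θ (x + ε)) - R (θ (x - ε))) / Real.sin p) -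
    1 / 2 * (G (θ (x - ε)) + (G Real.pi - G (θ (x + ε)))) with hΦ
  have hΦc : ContinuousAt Φ 0 := by
    have c1 : ContinuousAt (fun ε => θ (x + ε)) 0 :=
      (hθc.comp (continuous_const.add continuous_id)).continuousAt
    have c2 : ContinuousAt (fun ε => θ (x - ε)) 0 :=
      (hθc.comp (continuous_const.sub continuous_id)).continuousAt
    have r1 : ContinuousAt (fun ε => R (θ (x + ε))) 0 :=
      ContinuousAt.comp (g := R) (by simpa using hRc) c1
    have r2 : ContinuousAt (fun ε => R (θ (x - ε))) 0 :=
      ContinuousAt.comp (g := R) (by simpa using hRc) c2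
    have g1 : ContinuousAt (fun ε => G (θ (x + ε))) 0 :=
      ContinuousAt.comp (g := G) hGc.continuousAt c1
    have g2 : ContinuousAt (fun ε => G (θ (x - ε))) 0 :=
      ContinuousAt.comp (g := G) hGc.continuousAt c2
    exact (continuousAt_const.mul ((r1.sub r2).div_const _)).sub
      (continuousAt_const.mul (g2.add (continuousAt_const.sub g1)))
  have hΦ0 : Φ 0 = -(Real.pi / 2) * (kernelSum a p).re := by
    have hGpi : G Real.pi = Real.pi * (kernelSum a p).re := hdi
    simp only [hΦ, add_zero, sub_zero, hGpi]
    ring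
  rw [← hΦ0]
  refine (hΦc.tendsto.mono_left nhdsWithin_le_nhds).congr' ?_
  filter_upwards [hsmall] with ε hε
  obtain ⟨_, q1⟩ := exists_angle hε.2.1
  obtain ⟨_, q2⟩ := exists_angle hε.2.2
  change 2 - 2 * Real.cos (θ (x - ε)) = x - ε at q1
  change 2 - 2 * Real.cos (θ (x + ε)) = x + ε at q2
  rw [(left ε hε.1 hε.2.1).2, (right ε hε.1 hε.2.2).2]
  -- The cut-off is symmetric in λ = 2 - 2 cos q, so cos p - cos q equals -ε/2 and ε/2 at its two
  -- ends and the singular logarithms agree exactly.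
  have hlog : Real.log (Real.cos p - Real.cos (θ (x - ε))) =
      Real.log (Real.cos p - Real.cos (θ (x + ε))) := by
    rw [← Real.log_neg_eq_log]
    congr 1
    linarith
  have hsplit : ∫ q in θ (x + ε)..Real.pi, d q = G Real.pi - G (θ (x + ε)) := by
    rw [hG, intervalIntegral.integral_interval_sub_left (hdc.intervalIntegrable _ _)
      (hdc.intervalIntegrable _ _)]
  rw [hsplit]
  simp only [hΦ, hT, hR, hG, hlog]
  ring

/-! ### The real form of the constraint -/

/-- The integrand is (L(z) - L(w)) times the difference of z L' at z and w, up to constants, with w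
= 1/z. The diagonal products have mean value 0 since L(0) = 0, and the cross terms give Σ L(a_i). -/
theorem integral_phase_mul_kernelSum (ha : ∀ i, ‖a i‖ < 1)
    (hc : ∀ F : ℂ → ℂ, ∑ i, F ((starRingEnd ℂ) (a i)) = ∑ i, F (a i)) :
    ((∫ q in (0 : ℝ)..Real.pi, 2 * Real.sin q *
      (phase a q * (-(Real.pi / 2) * (kernelSum a q).re)) : ℝ) : ℂ) =
      Real.pi ^ 2 / 2 * ∑ i, logProd a (a i) := by
  have hsub := closedBall_subset_logDomain ha
  have hLd := differentiableOn_logProd (a := a)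
  have hAd := differentiableOn_eulerLogProd (a := a)
  have hL := continuous_comp_unitExp hsub hLd
  have hA := continuous_comp_unitExp hsub hAd
  have hL' : Continuous fun q : ℝ => logProd a (unitExp (-q)) := hL.comp continuous_neg
  have hA' : Continuous fun q : ℝ => eulerLogProd a (unitExp (-q)) := hA.comp continuous_neg
  have hLA := integral_unitExp_symm hsub (hLd.mul hAd)
  have hcross := integral_logProd_mul_eulerLogProd ha
  rw [← intervalIntegral.integral_ofReal]
  have key : ∀ q : ℝ, ((2 * Real.sin q *
      (phase a q * (-(Real.pi / 2) * (kernelSum a q).re)) : ℝ) : ℂ) =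
      Real.pi / 4 * ((logProd a (unitExp q) * eulerLogProd a (unitExp q) +
          logProd a (unitExp (-q)) * eulerLogProd a (unitExp (-q))) -
        (logProd a (unitExp q) * eulerLogProd a (unitExp (-q)) +
          logProd a (unitExp (-q)) * eulerLogProd a (unitExp q))) := by
    intro q
    have hk : ((kernelSum a q).re : ℂ) = kernelSum a q :=
      Complex.conj_eq_iff_re.mp (conj_kernelSum hc q)
    have hs := sin_mul_kernelSum ha q
    rw [Complex.ofReal_mul, Complex.ofReal_mul, Complex.ofReal_mul, phase_eq ha hc]
    push_cast at hs ⊢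
    rw [hk]
    linear_combination (-(Real.pi : ℂ) / 4 *
      (logProd a (unitExp q) - logProd a (unitExp (-q)))) * hs
  simp only [key]
  have hsub := intervalIntegral.integral_sub
    (((hL.mul hA).add (hL'.mul hA')).intervalIntegrable (μ := volume) 0 Real.pi)
    (((hL.mul hA').add (hL'.mul hA)).intervalIntegrable (μ := volume) 0 Real.pi)
  simp only [Pi.mul_apply, Pi.add_apply] at hLA hsub
  rw [intervalIntegral.integral_const_mul, hsub, hcross, hLA, logProd_zero]
  ring

theorem phase_constraint (ha : ∀ i, ‖a i‖ < 1)
    (hc : ∀ F : ℂ → ℂ, ∑ i, F ((starRingEnd ℂ) (a i)) = ∑ i, F (a i))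
    (hprod : ∏ i, ∏ j, (1 - a j * a i) = ∏ i, (1 - a i ^ 2)) :
    DifferentiableOn ℝ (spectralPhase (phase a)) (Set.Ioo 0 4) ∧
      IntervalIntegrable (fun x : ℝ => spectralPhase (phase a) x * ((x - 2) / (x * (x - 4))))
        volume 0 4 ∧
      ∃ K : ℝ → ℝ,
        (∀ x ∈ Set.Ioo (0 : ℝ) 4, HasPrincipalValue
          (fun y : ℝ => deriv (spectralPhase (phase a)) y / (y - x)) 0 4 x (K x)) ∧
        IntervalIntegrable (fun x : ℝ => spectralPhase (phase a) x * K x) volume 0 4 ∧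
        (∫ x in (0 : ℝ)..4, spectralPhase (phase a) x * ((x - 2) / (x * (x - 4)))) +
          1 / Real.pi * (∫ x in (0 : ℝ)..4, spectralPhase (phase a) x * K x) = 0 := by
  have hk := Complex.continuous_re.comp (continuous_kernelSum ha)
  have hφ := continuous_phase ha
  obtain ⟨h, hcont, heq, hint⟩ := exists_phase_mul_cot ha hc
  have e0 : 2 - 2 * Real.cos 0 = 0 := by simp
  have e4 : 2 - 2 * Real.cos Real.pi = 4 := by rw [Real.cos_pi]; norm_num
  have I1 := integral_spectral le_rfl Real.pi_pos.le le_rfl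
    (F := fun x : ℝ => spectralPhase (phase a) x * ((x - 2) / (x * (x - 4))))
    hcont.continuousOn (by
      intro q hq
      have hsin := (Real.sin_pos_of_pos_of_lt_pi hq.1 hq.2).ne'
      rw [spectralPhase_two_sub _ hq.1.le hq.2.le, ← heq q hq]
      have hden : (2 - 2 * Real.cos q) * (2 - 2 * Real.cos q - 4) = -4 * Real.sin q ^ 2 := by
        linear_combination 4 * Real.sin_sq_add_cos_sq q
      rw [hden]
      field_simp
      ring)
  rw [e0, e4] at I1
  have I2 := integral_spectral le_rfl Real.pi_pos.le le_rfl
    (F := fun x : ℝ => spectralPhase (phase a) x *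
      (-(Real.pi / 2) * (kernelSum a (Real.arccos (1 - x / 2))).re))
    (h := fun q => 2 * Real.sin q * (phase a q * (-(Real.pi / 2) * (kernelSum a q).re)))
    (Continuous.continuousOn ((continuous_const.mul Real.continuous_sin).mul
      (hφ.mul (continuous_const.mul hk)))) (by
      intro q hq
      rw [spectralPhase_two_sub _ hq.1.le hq.2.le,
        show 1 - (2 - 2 * Real.cos q) / 2 = Real.cos q by ring,
        Real.arccos_cos hq.1.le hq.2.le])
  rw [e0, e4] at I2
  refine ⟨fun x hx => ?_, I1.1, fun x => -(Real.pi / 2) *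
    (kernelSum a (Real.arccos (1 - x / 2))).re,
    fun x hx => hasPrincipalValue_deriv_phase ha hc hx, I2.1, ?_⟩
  · obtain ⟨hq, hqx⟩ := exists_angle hx
    have := hasDerivAt_spectralPhase hq (hasDerivAt_phase ha _)
    rw [hqx] at this
    exact this.differentiableAt.differentiableWithinAt
  · rw [I1.2, I2.2]
    apply Complex.ofReal_injective
    rw [Complex.ofReal_add, Complex.ofReal_mul, hint, integral_phase_mul_kernelSum ha hc,
      logProd_constraint ha hc hprod]
    have : (Real.pi : ℂ) ≠ 0 := by exact_mod_cast Real.pi_ne_zero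
    push_cast
    field_simp
    ring

end

end HalfLine

end

/-! ### Assembly of the two forms -/

theorem mainTheorem2 (v : ℕ → ℝ)
    (hsupp : ∃ J : ℕ, ∀ j : ℕ, J < j → v j = 0)
    (hbound : HalfLine.NoBoundStates v)
    (hone : HalfLine.jostFunction v 1 ≠ 0)
    (hneg : HalfLine.jostFunction v (-1) ≠ 0) :
    -- the scattering phase is well defined and satisfies the real constraint
    (∃! η : ℝ → ℝ, HalfLine.IsScatteringPhase v η) ∧
    (∀ η : ℝ → ℝ, HalfLine.IsScatteringPhase v η →
      DifferentiableOn ℝ (HalfLine.spectralPhase η) (Set.Ioo 0 4) ∧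
      IntervalIntegrable (fun x : ℝ => HalfLine.spectralPhase η x * ((x - 2) / (x * (x - 4))))
        MeasureTheory.volume 0 4 ∧
      ∃ K : ℝ → ℝ,
        (∀ x ∈ Set.Ioo (0 : ℝ) 4, HalfLine.HasPrincipalValue
          (fun y : ℝ => deriv (HalfLine.spectralPhase η) y / (y - x)) 0 4 x (K x)) ∧
        IntervalIntegrable (fun x : ℝ => HalfLine.spectralPhase η x * K x)
          MeasureTheory.volume 0 4 ∧
        (∫ x in (0 : ℝ)..4, HalfLine.spectralPhase η x * ((x - 2) / (x * (x - 4)))) +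
          1 / Real.pi * (∫ x in (0 : ℝ)..4, HalfLine.spectralPhase η x * K x) = 0) ∧
    -- the equivalent contour-integral identity for the logarithm of the Jost function
    (∃ L : ℂ → ℂ, HalfLine.IsLogJost v L) ∧
    (∀ L : ℂ → ℂ, HalfLine.IsLogJost v L →
      L 1 + L (-1) +
        (2 * Real.pi * Complex.I)⁻¹ * (∮ z in C(0, 1), L z⁻¹ * deriv L z) = 0) := by
  obtain ⟨n, a, ha, hP, hprod, hc⟩ :=
    HalfLine.exists_jostFunction_eq_prod v hsupp hbound hone hneg
  simp only [hP] at hprod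
  have hnz := HalfLine.jostFunction_ne_zero v hsupp hbound hone hneg
  have hφ := HalfLine.isScatteringPhase_phase ha hP hc
  refine ⟨⟨_, hφ, fun η hη => hη.unique hnz hφ⟩, fun η hη => ?_,
    ⟨_, HalfLine.isLogJost_logProd ha hP⟩, fun L hL => hL.constraint ha hP hc hprod⟩
  rw [hη.unique hnz hφ]
  exact HalfLine.phase_constraint ha hc hprod
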